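/- Let $d\ge 1$, $\alpha\in(-\frac12,\infty)^d$ and $\beta>0$. On $\mathbb R_+^d=(0,\infty)^d$ let $d\mu_\alpha(x)=\prod_{i=1}^d \frac{x_i^{\alpha_i}e^{-x_i}}{\Gamma(\alpha_i+1)}\,dx$, and let $L^\infty=L^\infty(\mathbb R_+^d,\mu_\alpha)$ (real- or complex-valued functions) with the essential supremum norm $\|\cdot\|_\infty$. For $f\in L^\infty$ let $T_0^\alpha f=f$ and, for $t>0$, $$T_t^\alpha f(x)=\int_{\mathbb R_+^d}\prod_{j=1}^d\frac{\Gamma(\alpha_j+1)}{1-e^{-t}}\,e^{-\frac{e^{-t}}{1-e^{-t}}(x_j+y_j)}\big(\sqrt{e^{-t}x_jy_j}\big)^{-\alpha_j}I_{\alpha_j}\Big(\frac{2\sqrt{e^{-t}x_jy_j}}{1-e^{-t}}\Big)f(y)\,d\mu_\alpha(y)$$ be the Laguerre semigroup, where $I_\nu$ is the modified Bessel function of the first kind, and let $$P_t^\alpha f(x)=\frac1{\sqrt\pi}\int_0^\infty\frac{e^{-u}}{\sqrt u}\,T^\alpha_{t^2/(4u)}f(x)\,du$$ be the Poisson-Laguerre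 semigroup. For a positive integer $k$ and $A\ge 0$ consider the condition $$(\ast)_{k,A}\qquad \Big\|\frac{\partial^kP_t^\alpha f}{\partial t^k}\Big\|_\infty\le A\,t^{-k+\beta}\quad\text{for all } t>0 .$$ For all $f\in L^\infty$ and $x\in\mathbb R_+^d$ the function $t\mapsto P_t^\alpha f(x)$ is infinitely differentiable on $(0,\infty)$. Let $k,l$ be integers greater than $\beta$. Then for every $f\in L^\infty$ the condition $(\ast)_{k,A}$ holds for some $A\ge 0$ if and only if $(\ast)_{l,A'}$ holds for some $A'\ge 0$. In this case there are a smallest $A=A_{\beta,k}(f)\ge 0$ with $(\ast)_{k,A}$ and a smallest $A'=A_{\beta,l}(f)\ge 0$ with $(\ast)_{l,A'}$, and they are comparable: there is a constant $C>0$, depending only on $d,\alpha,\beta,k,l$ and not on $f$, such that $$A_{\beta,k}(f)\le C\,A_{\beta,l}(f)\quad\text{and}\quad A_{\beta,l}(f)\le C\,A_{\beta,k}(f).$$ Consequently the Laguerre Lipschitz space $Lip_\beta(\mu_\alpha)$, defined as the set of all $f\in L^\infty$ that satisfy $(\ast)_{n,A}$ for some $A\ge 0$, where $n$ is the smallest integer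 greater than $\beta$, does not change if $n$ is replaced by any integer $k>\beta$. -/

import Mathlib

open MeasureTheory Set
open scoped ENNReal

noncomputable section

namespace Laguerre

/-- The open orthant `(0,∞)^d`. -/
def posOrthant (d : ℕ) : Set (Fin d → ℝ) := {x | ∀ i, 0 < x i}

/-- The Laguerre measure `∏ i, x_i ^ α_i * exp (-x_i) / Γ(α_i + 1) dx` on `(0,∞)^d`, viewed as a
measure on `ℝ^d` that is carried by the orthant. -/
def laguerreMeasure {d : ℕ} (α : Fin d → ℝ) : Measure (Fin d → ℝ) :=
  (volume.restrict (posOrthant d)).withDensity fun x =>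
    ENNReal.ofReal (∏ i, x i ^ α i * Real.exp (-x i) / Real.Gamma (α i + 1))

/-- The modified Bessel function of the first kind of order `ν` (used for `z > 0`, `ν > -1`),
`I_ν(z) = ∑ m, (z/2)^(2m+ν) / (m! Γ(m+ν+1))`. -/
def besselI (ν z : ℝ) : ℝ :=
  ∑' m : ℕ, (z / 2) ^ (2 * (m : ℝ) + ν) / ((m.factorial : ℝ) * Real.Gamma ((m : ℝ) + ν + 1))

/-- The Laguerre heat kernel `G_t^α(x,y)` with respect to the Laguerre measure, for `t > 0`. -/
def heatKernel {d : ℕ} (α : Fin d → ℝ) (t : ℝ) (x y : Fin d → ℝ) : ℝ :=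
  ∏ j, Real.Gamma (α j + 1) / (1 - Real.exp (-t)) *
    Real.exp (-(Real.exp (-t) / (1 - Real.exp (-t))) * (x j + y j)) *
    Real.sqrt (Real.exp (-t) * x j * y j) ^ (-α j) *
    besselI (α j) (2 * Real.sqrt (Real.exp (-t) * x j * y j) / (1 - Real.exp (-t)))

variable {𝕜 : Type*} [RCLike 𝕜]

open Classical in
/-- The Laguerre heat semigroup `T_t^α f(x)`, `t ≥ 0`, with `T_0^α f = f`. -/
def heatSemigroup {d : ℕ} (α : Fin d → ℝ) (t : ℝ) (f : (Fin d → ℝ) → 𝕜) (x : Fin d → ℝ) : 𝕜 :=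
  if t = 0 then f x else ∫ y, heatKernel α t x y • f y ∂(laguerreMeasure α)

/-- The Poisson-Laguerre semigroup `P_t^α f(x)`, `t ≥ 0`, obtained by subordination. -/
def poissonSemigroup {d : ℕ} (α : Fin d → ℝ) (t : ℝ) (f : (Fin d → ℝ) → 𝕜) (x : Fin d → ℝ) : 𝕜 :=
  (1 / Real.sqrt Real.pi) •
    ∫ u in Ioi (0 : ℝ), (Real.exp (-u) / Real.sqrt u) • heatSemigroup α (t ^ 2 / (4 * u)) f x

/-- The condition `‖∂_t^k P_t^α f‖_∞ ≤ A t^(-k+β)` for all `t > 0`; `‖·‖_∞` is the essential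
supremum norm on `(0,∞)^d`. -/
def DerivBound {d : ℕ} (α : Fin d → ℝ) (β : ℝ) (k : ℕ) (f : (Fin d → ℝ) → 𝕜) (A : ℝ) : Prop :=
  ∀ t : ℝ, 0 < t →
    eLpNorm (fun x => iteratedDeriv k (fun s : ℝ => poissonSemigroup α s f x) t) ∞
      (laguerreMeasure α) ≤ ENNReal.ofReal (A * t ^ (-(k : ℝ) + β))

/-- The constants `A ≥ 0` that are admissible in the condition of order `k`. -/
def admissibleConsts {d : ℕ} (α : Fin d → ℝ) (β : ℝ) (k : ℕ) (f : (Fin d → ℝ) → 𝕜) : Set ℝ :=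
  {A | 0 ≤ A ∧ DerivBound α β k f A}

/-- The infimum of the admissible constants of order `k` (meaningful if there are any). -/
def smallestConst {d : ℕ} (α : Fin d → ℝ) (β : ℝ) (k : ℕ) (f : (Fin d → ℝ) → 𝕜) : ℝ :=
  sInf (admissibleConsts α β k f)

variable (𝕜) in
/-- The bounded functions that satisfy the condition with derivative order `k`. -/
def lipOfOrder {d : ℕ} (α : Fin d → ℝ) (β : ℝ) (k : ℕ) : Set ((Fin d → ℝ) → 𝕜) :=
  {f | MemLp f ∞ (laguerreMeasure α) ∧ (admissibleConsts α β k f).Nonempty}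

variable (𝕜) in
/-- The Laguerre Lipschitz space `Lip_β(μ_α)`: the derivative order is the smallest integer
greater than `β` (`β > 0`). -/
def lip {d : ℕ} (α : Fin d → ℝ) (β : ℝ) : Set ((Fin d → ℝ) → 𝕜) :=
  lipOfOrder 𝕜 α β (⌊β⌋₊ + 1)

end Laguerre

end

/-!
The proof works with a form of subordination without singularities. With `u = (t v)² / 4`,
`P_t f (x) = π^(-1/2) ∫_0^∞ t exp (-(t v)² / 4) T_{v⁻²} f (x) dv`,
so the parameter `t` enters only through a Gaussian kernel. Its `k`-th derivative in `t` is
`t^(1-k) p_k(t v) exp (-(t v)² / 4)` with a polynomial `p_k`, and has `L¹` norm `O(t⁻ᵏ)`. As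
`T_s f (x)` is bounded in `s`, `t ↦ P_t f (x)` is smooth and `‖∂_t^k P_t f‖_∞ ≤ C_k t⁻ᵏ ‖f‖_∞`
(`hasDerivAt_subord`, `exists_norm_subord_le`).

Conditions of consecutive orders are then compared.

* From `k` to `k + 1`: by the semigroup law, `∂_t^(k+1) P_t f` at time `t + s` is
  `∂_t P_t (∂_s^k P_s f)`, and `∂_t P_t` has norm `O(1/t)` on `L^∞`; take both times equal
  (`exists_norm_poissonDeriv_succ_le`).
* From `k + 1` to `k`, for `k > β`: integrate `∂_s^(k+1) P_s f` over `(t,∞)`; the boundary term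
  vanishes at infinity, and `s^(-k-1+β)` is integrable there (`norm_poissonDeriv_le_of_succ`).

The semigroup law for `P` rests on two convolution identities, both obtained from the uniqueness of
Laplace transforms (`ext_of_laplace`). The subordinator at time `t` has Laplace transform
`exp (-t √l)`, so its laws form a convolution semigroup (`map_add_subordinator`). The
one-dimensional heat kernel `K_t(x, ·)` has Laplace transform
`(1 + l(1-r))^(-a-1) exp (-r l x / (1 + l(1-r)))`, `r = exp (-t)`, which is stable under iteration;
this gives the Chapman–Kolmogorov equation (`lintegral_heatKernel₁_mul`), and, by products, the
semigroup law for `T` (`heatSemigroup_heatSemigroup`).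

The set of admissible constants is closed, so that it has a least element.
-/

/-! ### The subordination kernel and its derivatives -/

namespace Laguerre

open Polynomial in
/-- The polynomials `p_k` with
`∂_t^k (t exp (-(t v)² / 4)) = t ^ (1 - k) * p_k (t v) * exp (-(t v)² / 4)`. -/
noncomputable def subordPoly : ℕ → Polynomial ℝ
  | 0 => 1
  | k + 1 => C (1 - (k : ℝ)) * subordPoly k + X * derivative (subordPoly k)
      - C (1 / 2) * X ^ 2 * subordPoly k

/-- The `k`-th `t`-derivative of the subordination kernel `t exp (-(t v)² / 4) / √π`. Here `v`
stands for the heat time `v⁻²`; in this variable the kernel has no singularity at `v = 0`. -/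
noncomputable def subordKernel (k : ℕ) (t v : ℝ) : ℝ :=
  (Real.sqrt Real.pi)⁻¹ * t ^ (1 - (k : ℤ)) * (subordPoly k).eval (t * v) *
    Real.exp (-(t * v) ^ 2 / 4)

theorem subordKernel_zero (t v : ℝ) :
    subordKernel 0 t v = (Real.sqrt Real.pi)⁻¹ * t * Real.exp (-(t * v) ^ 2 / 4) := by
  simp [subordKernel, subordPoly]

theorem continuous_subordKernel (k : ℕ) (t : ℝ) : Continuous (subordKernel k t) := by
  unfold subordKernel
  fun_prop

theorem hasDerivAt_subordKernel (k : ℕ) {t : ℝ} (ht : 0 < t) (v : ℝ) :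
    HasDerivAt (fun s => subordKernel k s v) (subordKernel (k + 1) t v) t := by
  have h1 : HasDerivAt (fun s : ℝ => s ^ (1 - (k : ℤ)))
      (((1 - (k : ℤ) : ℤ) : ℝ) * t ^ (1 - (k : ℤ) - 1)) t :=
    hasDerivAt_zpow _ _ (Or.inl ht.ne')
  have h0 : HasDerivAt (fun s : ℝ => s * v) v t := by
    simpa using (hasDerivAt_id t).mul_const v
  have h2 : HasDerivAt (fun s : ℝ => (subordPoly k).eval (s * v))
      ((Polynomial.derivative (subordPoly k)).eval (t * v) * v) t :=
    HasDerivAt.comp (h₂ := fun y => (subordPoly k).eval y) t ((subordPoly k).hasDerivAt (t * v)) h0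
  have h3 : HasDerivAt (fun s : ℝ => Real.exp (-(s * v) ^ 2 / 4))
      (Real.exp (-(t * v) ^ 2 / 4) * (-(2 * (t * v) * v) / 4)) t := by
    have := (((h0.pow 2).neg).div_const 4).exp
    refine this.congr_deriv ?_
    simp [mul_assoc]
  have h := (((h1.const_mul (Real.sqrt Real.pi)⁻¹).mul h2).mul h3)
  refine h.congr_deriv ?_
  have e1 : t ^ (1 - (k : ℤ)) = t ^ (1 - ((k + 1 : ℕ) : ℤ)) * t := by
    rw [← zpow_add_one₀ ht.ne']; congr 1; push_cast; ring
  have e2 : t ^ (1 - (k : ℤ) - 1) = t ^ (1 - ((k + 1 : ℕ) : ℤ)) := by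
    congr 1; push_cast; ring
  simp only [subordKernel, subordPoly, e1, e2, Polynomial.eval_add, Polynomial.eval_sub,
    Polynomial.eval_mul, Polynomial.eval_C, Polynomial.eval_X, Polynomial.eval_pow, Pi.mul_apply]
  push_cast
  ring

theorem exists_abs_eval_mul_exp_le (p : Polynomial ℝ) :
    ∃ C : ℝ, 0 < C ∧ ∀ x : ℝ, |p.eval x| * Real.exp (-x ^ 2 / 8) ≤ C := by
  induction p using Polynomial.induction_on' with
  | add p q hp hq =>
    obtain ⟨C, hC, hp⟩ := hp
    obtain ⟨D, hD, hq⟩ := hq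
    refine ⟨C + D, by positivity, fun x => ?_⟩
    rw [Polynomial.eval_add]
    calc _ ≤ (|p.eval x| + |q.eval x|) * Real.exp (-x ^ 2 / 8) := by gcongr; exact abs_add_le _ _
      _ ≤ C + D := by rw [add_mul]; exact add_le_add (hp x) (hq x)
  | monomial n a =>
    refine ⟨|a| * (1 + 8 ^ n * n.factorial) + 1, by positivity, fun x => ?_⟩
    have h1 : |x| ^ n ≤ 1 + (x ^ 2) ^ n := by
      rw [← sq_abs, ← pow_mul, mul_comm, pow_mul]
      nlinarith [sq_nonneg (|x| ^ n - 1), sq_nonneg (|x| ^ n), pow_nonneg (abs_nonneg x) n]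
    have h2 : (x ^ 2) ^ n ≤ 8 ^ n * n.factorial * Real.exp (x ^ 2 / 8) := by
      have := Real.pow_div_factorial_le_exp (x ^ 2 / 8) (by positivity) n
      rw [div_le_iff₀ (by positivity), div_pow, div_le_iff₀ (by positivity)] at this
      linarith
    have h3 : 1 ≤ Real.exp (x ^ 2 / 8) := Real.one_le_exp (by positivity)
    have h4 : Real.exp (-x ^ 2 / 8) = (Real.exp (x ^ 2 / 8))⁻¹ := by
      rw [← Real.exp_neg]; congr 1; ring
    rw [Polynomial.eval_monomial, abs_mul, abs_pow, h4, ← div_eq_mul_inv,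
      div_le_iff₀ (Real.exp_pos _)]
    have h5 : |x| ^ n ≤ (1 + 8 ^ n * n.factorial) * Real.exp (x ^ 2 / 8) := by nlinarith
    calc |a| * |x| ^ n ≤ |a| * ((1 + 8 ^ n * n.factorial) * Real.exp (x ^ 2 / 8)) := by gcongr
      _ ≤ _ := by nlinarith

/-- Gaussian bound for the derivatives of the subordination kernel. -/
theorem exists_abs_subordKernel_le (k : ℕ) :
    ∃ C : ℝ, 0 < C ∧ ∀ t : ℝ, 0 < t → ∀ v : ℝ,
      |subordKernel k t v| ≤ C * t ^ (1 - (k : ℤ)) * Real.exp (-(t ^ 2 / 8) * v ^ 2) := by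
  obtain ⟨C, hC, h⟩ := exists_abs_eval_mul_exp_le (subordPoly k)
  refine ⟨(Real.sqrt Real.pi)⁻¹ * C, by positivity, fun t ht v => ?_⟩
  have e : Real.exp (-(t * v) ^ 2 / 4)
      = Real.exp (-(t * v) ^ 2 / 8) * Real.exp (-(t ^ 2 / 8) * v ^ 2) := by
    rw [← Real.exp_add]; congr 1; ring
  have ht' : 0 < t ^ (1 - (k : ℤ)) := zpow_pos ht _
  rw [subordKernel, abs_mul, abs_mul, abs_mul, abs_of_pos (Real.exp_pos _), abs_of_pos ht',
    abs_of_pos (by positivity : 0 < (Real.sqrt Real.pi)⁻¹), e]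
  calc _ = (Real.sqrt Real.pi)⁻¹ * t ^ (1 - (k : ℤ)) * Real.exp (-(t ^ 2 / 8) * v ^ 2) *
        (|(subordPoly k).eval (t * v)| * Real.exp (-(t * v) ^ 2 / 8)) := by ring
    _ ≤ (Real.sqrt Real.pi)⁻¹ * t ^ (1 - (k : ℤ)) * Real.exp (-(t ^ 2 / 8) * v ^ 2) * C := by
        gcongr; exact h _
    _ = _ := by ring

theorem integrable_subordKernel (k : ℕ) {t : ℝ} (ht : 0 < t) :
    IntegrableOn (subordKernel k t) (Ioi 0) := by
  obtain ⟨C, hC, h⟩ := exists_abs_subordKernel_le k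
  have hg : Integrable fun v : ℝ => C * t ^ (1 - (k : ℤ)) * Real.exp (-(t ^ 2 / 8) * v ^ 2) :=
    (integrable_exp_neg_mul_sq (by positivity)).const_mul _
  exact (hg.mono' (continuous_subordKernel k t).aestronglyMeasurable
    (Filter.Eventually.of_forall fun v => by simpa using h t ht v)).integrableOn

/-- The `L¹` norm of the `k`-th derivative of the subordination kernel is `O(t⁻ᵏ)`. -/
theorem exists_integral_abs_subordKernel_le (k : ℕ) :
    ∃ C : ℝ, 0 < C ∧ ∀ t : ℝ, 0 < t →
      ∫ v in Ioi (0 : ℝ), |subordKernel k t v| ≤ C * t ^ (-(k : ℝ)) := by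
  obtain ⟨C, hC, h⟩ := exists_abs_subordKernel_le k
  refine ⟨C * (Real.sqrt (8 * Real.pi) / 2), by positivity, fun t ht => ?_⟩
  have hg : Integrable fun v : ℝ => C * t ^ (1 - (k : ℤ)) * Real.exp (-(t ^ 2 / 8) * v ^ 2) :=
    (integrable_exp_neg_mul_sq (by positivity)).const_mul _
  calc _ ≤ ∫ v in Ioi (0 : ℝ), C * t ^ (1 - (k : ℤ)) * Real.exp (-(t ^ 2 / 8) * v ^ 2) :=
        integral_mono (integrable_subordKernel k ht).abs hg.integrableOn fun v => h t ht v
    _ = _ := by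
        rw [integral_const_mul, integral_gaussian_Ioi]
        have e : Real.pi / (t ^ 2 / 8) = (8 * Real.pi) / t ^ 2 := by field_simp
        rw [e, Real.sqrt_div (by positivity), Real.sqrt_sq ht.le, Real.rpow_neg ht.le,
          Real.rpow_natCast, zpow_sub₀ ht.ne', zpow_one, zpow_natCast]
        field_simp

section Subordination

variable {E : Type*} [NormedAddCommGroup E] [NormedSpace ℝ E]

/-- The `k`-th derivative in `t` of the subordinated average
`π^(-1/2) ∫_0^∞ t exp (-(t v)² / 4) h v dv`. -/
noncomputable def subord (k : ℕ) (t : ℝ) (h : ℝ → E) : E :=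
  ∫ v in Ioi (0 : ℝ), subordKernel k t v • h v

theorem subord_congr {k : ℕ} {t : ℝ} {h h' : ℝ → E} (H : ∀ v, 0 < v → h v = h' v) :
    subord k t h = subord k t h' :=
  setIntegral_congr_fun measurableSet_Ioi fun v hv => by simp only [H v hv]

theorem integrable_subordKernel_smul (k : ℕ) {t : ℝ} (ht : 0 < t) {h : ℝ → E} {M : ℝ}
    (hm : AEStronglyMeasurable h (volume.restrict (Ioi 0))) (hM : ∀ v, 0 < v → ‖h v‖ ≤ M) :
    IntegrableOn (fun v => subordKernel k t v • h v) (Ioi 0) := by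
  refine ((integrable_subordKernel k ht).abs.const_mul M).mono'
    ((continuous_subordKernel k t).aestronglyMeasurable.smul hm) ?_
  filter_upwards [ae_restrict_mem measurableSet_Ioi] with v hv
  rw [norm_smul, mul_comm, Real.norm_eq_abs]
  exact mul_le_mul_of_nonneg_right (hM v hv) (abs_nonneg _)

theorem exists_norm_subord_le (k : ℕ) :
    ∃ C : ℝ, 0 < C ∧ ∀ {E : Type*} [NormedAddCommGroup E] [NormedSpace ℝ E] (t : ℝ), 0 < t →
      ∀ (h : ℝ → E) (M : ℝ), 0 ≤ M → (∀ v, 0 < v → ‖h v‖ ≤ M) →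
        ‖subord k t h‖ ≤ C * t ^ (-(k : ℝ)) * M := by
  obtain ⟨C, hC, H⟩ := exists_integral_abs_subordKernel_le k
  refine ⟨C, hC, fun {E} _ _ t ht h M hM0 hM => ?_⟩
  calc ‖subord k t h‖ ≤ ∫ v in Ioi (0 : ℝ), |subordKernel k t v| * M := by
        refine norm_integral_le_of_norm_le ((integrable_subordKernel k ht).abs.mul_const M) ?_
        filter_upwards [ae_restrict_mem measurableSet_Ioi] with v hv
        rw [norm_smul, Real.norm_eq_abs]
        exact mul_le_mul_of_nonneg_left (hM v hv) (abs_nonneg _)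
    _ ≤ C * t ^ (-(k : ℝ)) * M := by
        rw [integral_mul_const]
        exact mul_le_mul_of_nonneg_right (H t ht) hM0

theorem hasDerivAt_subord (k : ℕ) {t : ℝ} (ht : 0 < t) {h : ℝ → E} {M : ℝ}
    (hm : AEStronglyMeasurable h (volume.restrict (Ioi 0))) (hM : ∀ v, 0 < v → ‖h v‖ ≤ M) :
    HasDerivAt (fun s => subord k s h) (subord (k + 1) t h) t := by
  obtain ⟨C, hC, H⟩ := exists_abs_subordKernel_le (k + 1)
  have hM0 : 0 ≤ M := (norm_nonneg _).trans (hM 1 one_pos)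
  have hs : Ioi (t / 2) ∈ nhds t := Ioi_mem_nhds (by linarith)
  refine (hasDerivAt_integral_of_dominated_loc_of_deriv_le
    (F := fun s v => subordKernel k s v • h v) (F' := fun s v => subordKernel (k + 1) s v • h v)
    (bound := fun v => C * (t / 2) ^ (-(k : ℤ)) * Real.exp (-((t / 2) ^ 2 / 8) * v ^ 2) * M)
    hs ?_ (integrable_subordKernel_smul k ht hm hM)
    (((continuous_subordKernel (k + 1) t).aestronglyMeasurable).smul hm) ?_ ?_ ?_).2
  · exact Filter.Eventually.of_forall fun s =>
      ((continuous_subordKernel k s).aestronglyMeasurable).smul hm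
  · filter_upwards [ae_restrict_mem measurableSet_Ioi] with v hv s hs
    have hs0 : 0 < t / 2 := by positivity
    have hs1 : t / 2 < s := hs
    have hs' : 0 < s := hs0.trans hs
    have e : (1 - ((k + 1 : ℕ) : ℤ)) = -(k : ℤ) := by push_cast; ring
    rw [norm_smul, Real.norm_eq_abs]
    refine mul_le_mul ((H s hs' v).trans ?_) (hM v hv) (norm_nonneg _) (by positivity)
    rw [e]
    have h1 : s ^ (-(k : ℤ)) ≤ (t / 2) ^ (-(k : ℤ)) := by
      rw [zpow_neg, zpow_neg, zpow_natCast, zpow_natCast]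
      exact inv_anti₀ (by positivity) (pow_le_pow_left₀ hs0.le hs1.le k)
    have h2 : -(s ^ 2 / 8) * v ^ 2 ≤ -((t / 2) ^ 2 / 8) * v ^ 2 := by
      have : (t / 2) ^ 2 ≤ s ^ 2 := pow_le_pow_left₀ hs0.le hs1.le 2
      nlinarith [sq_nonneg v]
    gcongr
  · exact (((integrable_exp_neg_mul_sq (by positivity)).const_mul _).mul_const _).integrableOn
  · filter_upwards with v s hs
    have hs1 : t / 2 < s := hs
    exact (hasDerivAt_subordKernel k (by linarith) v).smul_const _

theorem iteratedDeriv_subord (k : ℕ) {t : ℝ} (ht : 0 < t) {h : ℝ → E} {M : ℝ}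
    (hm : AEStronglyMeasurable h (volume.restrict (Ioi 0))) (hM : ∀ v, 0 < v → ‖h v‖ ≤ M) :
    iteratedDeriv k (fun s => subord 0 s h) t = subord k t h := by
  induction k generalizing t with
  | zero => simp
  | succ k ih =>
    rw [iteratedDeriv_succ]
    have : iteratedDeriv k (fun s => subord 0 s h) =ᶠ[nhds t] fun s => subord k s h := by
      filter_upwards [Ioi_mem_nhds ht] with s hs using ih hs
    rw [this.deriv_eq]
    exact (hasDerivAt_subord k ht hm hM).deriv

theorem contDiffOn_subord (k : ℕ) {h : ℝ → E} {M : ℝ}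
    (hm : AEStronglyMeasurable h (volume.restrict (Ioi 0))) (hM : ∀ v, 0 < v → ‖h v‖ ≤ M) :
    ContDiffOn ℝ ((⊤ : ℕ∞) : WithTop ℕ∞) (fun s => subord k s h) (Ioi 0) := by
  refine contDiffOn_infty.2 fun n => ?_
  induction n generalizing k with
  | zero =>
    exact contDiffOn_zero.2 fun s hs =>
      (hasDerivAt_subord k hs hm hM).continuousAt.continuousWithinAt
  | succ n ih =>
    rw [Nat.cast_add, Nat.cast_one, contDiffOn_succ_iff_deriv_of_isOpen isOpen_Ioi]
    refine ⟨fun s hs => (hasDerivAt_subord k hs hm hM).differentiableAt.differentiableWithinAt,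
      by simp, (ih (k + 1)).congr fun s hs => (hasDerivAt_subord k hs hm hM).deriv⟩

end Subordination

end Laguerre

/-! ### Laplace transforms and the semigroup law for subordination -/

namespace Laguerre

open ProbabilityTheory Filter Topology in
/-- A finite measure on `[0,∞)` is determined by its Laplace transform. The complex moment
generating function is analytic on the left half-plane, so it is determined there by its values on
the negative reals; its boundary values on the imaginary axis are the characteristic function. -/
theorem ext_of_laplace {μ ν : Measure ℝ} [IsFiniteMeasure μ] [IsFiniteMeasure ν]
    (hμ : ∀ᵐ x ∂μ, 0 ≤ x) (hν : ∀ᵐ x ∂ν, 0 ≤ x)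
    (h : ∀ l : ℝ, 0 < l → ∫ x, Real.exp (-l * x) ∂μ = ∫ x, Real.exp (-l * x) ∂ν) : μ = ν := by
  have hint : ∀ (μ : Measure ℝ) [IsFiniteMeasure μ], (∀ᵐ x ∂μ, 0 ≤ x) →
      {z : ℂ | z.re < 0} ⊆ {z : ℂ | z.re ∈ interior (integrableExpSet id μ)} := by
    intro μ _ hμ z hz
    have : Iio (0 : ℝ) ⊆ integrableExpSet id μ := by
      intro t ht
      refine Integrable.of_bound (by fun_prop) 1 ?_
      filter_upwards [hμ] with x hx
      rw [Real.norm_of_nonneg (Real.exp_pos _).le]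
      exact Real.exp_le_one_iff.2 (mul_nonpos_of_nonpos_of_nonneg (le_of_lt ht) hx)
    exact interior_maximal this isOpen_Iio hz
  have heq : EqOn (complexMGF id μ) (complexMGF id ν) {z : ℂ | z.re < 0} := by
    refine AnalyticOnNhd.eqOn_of_preconnected_of_frequently_eq
      (analyticOnNhd_complexMGF.mono (hint μ hμ)) (analyticOnNhd_complexMGF.mono (hint ν hν))
      (convex_halfSpace_re_lt 0).isPreconnected (z₀ := ((-1 : ℝ) : ℂ)) (by simp) ?_
    have h_real : ∃ᶠ x : ℝ in 𝓝[≠] (-1), complexMGF id μ x = complexMGF id ν x := by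
      refine Eventually.frequently ?_
      filter_upwards [mem_nhdsWithin_of_mem_nhds (Iio_mem_nhds (by norm_num : (-1 : ℝ) < 0))]
        with x hx
      rw [complexMGF_ofReal, complexMGF_ofReal]
      have := h (-x) (by simpa using hx)
      simpa [mgf] using this
    rw [frequently_iff_seq_forall] at h_real ⊢
    obtain ⟨xs, hx_tendsto, hx_eq⟩ := h_real
    refine ⟨fun n => xs n, ?_, fun n => by simp [hx_eq]⟩
    rw [tendsto_nhdsWithin_iff] at hx_tendsto ⊢
    refine ⟨(Complex.continuous_ofReal.tendsto _).comp hx_tendsto.1, ?_⟩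
    filter_upwards [hx_tendsto.2] with n hn
    simpa using fun H : ((xs n : ℝ) : ℂ) = -1 => hn (by
      have : ((xs n : ℝ) : ℂ) = ((-1 : ℝ) : ℂ) := by simpa using H
      exact_mod_cast this)
  have hlim : ∀ (μ : Measure ℝ) [IsFiniteMeasure μ], (∀ᵐ x ∂μ, 0 ≤ x) → ∀ ξ : ℝ,
      Tendsto (fun n : ℕ => complexMGF id μ ((-(1 / ((n : ℝ) + 1)) : ℝ) + ξ * Complex.I)) atTop
        (𝓝 (charFun μ ξ)) := by
    intro μ _ hμ ξ
    rw [← complexMGF_id_mul_I]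
    refine tendsto_integral_of_dominated_convergence (fun _ => 1) (fun n => by fun_prop)
      (integrable_const _) (fun n => ?_) ?_
    · filter_upwards [hμ] with x hx
      rw [Complex.norm_exp]
      refine Real.exp_le_one_iff.2 ?_
      simp only [id, Complex.mul_re, Complex.add_re, Complex.ofReal_re, Complex.I_re,
        Complex.ofReal_im, Complex.I_im, Complex.add_im, Complex.mul_im]
      have : 0 ≤ 1 / ((n : ℝ) + 1) := by positivity
      nlinarith
    · filter_upwards with x
      have h1 : Tendsto (fun n : ℕ => (((-(1 / ((n : ℝ) + 1)) : ℝ) : ℂ) + ξ * Complex.I)) atTop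
          (𝓝 (ξ * Complex.I)) := by
        have h0 : Tendsto (fun n : ℕ => -(1 / ((n : ℝ) + 1))) atTop (𝓝 0) := by
          simpa using (tendsto_one_div_add_atTop_nhds_zero_nat (𝕜 := ℝ)).neg
        simpa using ((Complex.continuous_ofReal.tendsto _).comp h0).add_const ((ξ : ℂ) * Complex.I)
      exact (Complex.continuous_exp.tendsto _).comp (h1.mul_const _)
  refine Measure.ext_of_charFun (funext fun ξ => ?_)
  refine tendsto_nhds_unique (hlim μ hμ ξ) ((hlim ν hν ξ).congr fun n => (heq ?_).symm)
  simp only [mem_ofPred_eq, Complex.add_re, Complex.ofReal_re, Complex.mul_re, Complex.I_re,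
    Complex.ofReal_im, Complex.I_im]
  have : 0 < 1 / ((n : ℝ) + 1) := by positivity
  linarith

/-- The Cauchy–Schlömilch substitution for a Gaussian: `v ↦ a v - b / v` maps `(0,∞)` onto `ℝ`, and
the two summands of its derivative contribute equally, as `v ↦ (b / a) / v` exchanges them. -/
theorem integral_exp_neg_sub_div_sq {a b : ℝ} (ha : 0 < a) (hb : 0 < b) :
    ∫ v in Ioi (0 : ℝ), Real.exp (-(a * v - b / v) ^ 2) = Real.sqrt Real.pi / (2 * a) := by
  set F : ℝ → ℝ := fun v => a * v - b / v with hF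
  have hd : ∀ v ∈ Ioi (0 : ℝ), HasDerivWithinAt F (a + b / v ^ 2) (Ioi 0) v := by
    intro v hv
    have hv' : v ≠ 0 := (ne_of_gt hv)
    have h1 := ((hasDerivAt_id v).const_mul a).sub ((hasDerivAt_inv hv').const_mul b)
    refine (h1.congr_deriv ?_).hasDerivWithinAt
    field_simp
    ring
  have hmono : StrictMonoOn F (Ioi 0) := by
    intro x hx y hy hxy
    have : b / y < b / x := div_lt_div_of_pos_left hb hx hxy
    have : a * x < a * y := by gcongr
    simp only [hF]; linarith
  have himg : F '' Ioi 0 = univ := by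
    refine eq_univ_of_forall fun w => ?_
    have h0 : 0 ≤ w ^ 2 + 4 * a * b := by positivity
    have h1 : |w| < Real.sqrt (w ^ 2 + 4 * a * b) := by
      refine Real.lt_sqrt_of_sq_lt ?_
      rw [sq_abs]
      have : 0 < a * b := by positivity
      linarith
    have h2 := (abs_lt.1 h1).1
    have h3 := Real.sq_sqrt h0
    set r := Real.sqrt (w ^ 2 + 4 * a * b)
    have h4 : 0 < w + r := by linarith
    refine ⟨(w + r) / (2 * a), mem_Ioi.2 (by positivity), ?_⟩
    simp only [hF]
    field_simp
    linarith
  have hab : ∀ v : ℝ, 0 < v → |a + b / v ^ 2| = a + b / v ^ 2 := fun v hv =>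
    abs_of_pos (by positivity)
  have hG : Integrable fun w : ℝ => Real.exp (-w ^ 2) := by
    simpa using integrable_exp_neg_mul_sq one_pos
  have hI : ∫ v in Ioi (0 : ℝ), (a + b / v ^ 2) * Real.exp (-(F v) ^ 2) = Real.sqrt Real.pi := by
    have := integral_image_eq_integral_abs_deriv_smul measurableSet_Ioi hd hmono.injOn
      (fun w => Real.exp (-w ^ 2))
    rw [himg, Measure.restrict_univ] at this
    have hg : ∫ w : ℝ, Real.exp (-w ^ 2) = Real.sqrt Real.pi := by
      simpa using integral_gaussian 1
    rw [← hg, this]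
    exact setIntegral_congr_fun measurableSet_Ioi fun v hv => by simp only [hab v hv, smul_eq_mul]
  have hint : IntegrableOn (fun v => (a + b / v ^ 2) * Real.exp (-(F v) ^ 2)) (Ioi 0) := by
    have := (integrableOn_image_iff_integrableOn_abs_deriv_smul measurableSet_Ioi hd hmono.injOn
      (fun w => Real.exp (-w ^ 2))).1 hG.integrableOn
    exact this.congr_fun (fun v hv => by simp only [hab v hv, smul_eq_mul]) measurableSet_Ioi
  have hFm : Measurable F := by fun_prop
  have hi1 : IntegrableOn (fun v => a * Real.exp (-(F v) ^ 2)) (Ioi 0) := by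
    refine hint.mono' (by fun_prop) ?_
    filter_upwards [ae_restrict_mem measurableSet_Ioi] with v hv
    rw [Real.norm_of_nonneg (by positivity)]
    gcongr
    have : 0 ≤ b / v ^ 2 := by positivity
    linarith
  have hi2 : IntegrableOn (fun v => b / v ^ 2 * Real.exp (-(F v) ^ 2)) (Ioi 0) :=
    (hint.sub hi1).congr (Filter.Eventually.of_forall fun v => by simp; ring)
  have hsymm : ∫ v in Ioi (0 : ℝ), b / v ^ 2 * Real.exp (-(F v) ^ 2)
      = ∫ v in Ioi (0 : ℝ), a * Real.exp (-(F v) ^ 2) := by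
    have himg' : (fun v : ℝ => b / a / v) '' Ioi 0 = Ioi 0 := by
      ext w
      constructor
      · rintro ⟨v, hv, rfl⟩
        have : (0 : ℝ) < v := hv
        exact div_pos (by positivity) this
      · intro hw
        have hw' : (0 : ℝ) < w := hw
        exact ⟨b / a / w, div_pos (by positivity) hw', by field_simp⟩
    have hd' : ∀ v ∈ Ioi (0 : ℝ),
        HasDerivWithinAt (fun v : ℝ => b / a / v) (-(b / a) / v ^ 2) (Ioi 0) v := by
      intro v hv
      have hv' : v ≠ 0 := (ne_of_gt hv)
      have h1 := (hasDerivAt_inv hv').const_mul (b / a)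
      refine (h1.congr_deriv ?_).hasDerivWithinAt
      field_simp
    have hinj : InjOn (fun v : ℝ => b / a / v) (Ioi 0) := by
      intro x hx y hy hxy
      have hx' : x ≠ 0 := (ne_of_gt hx)
      have hy' : y ≠ 0 := (ne_of_gt hy)
      have : b / a ≠ 0 := by positivity
      simp only at hxy
      field_simp at hxy
      exact hxy.symm
    have := integral_image_eq_integral_abs_deriv_smul measurableSet_Ioi hd' hinj
      (fun w => a * Real.exp (-(F w) ^ 2))
    rw [himg'] at this
    rw [this]
    refine setIntegral_congr_fun measurableSet_Ioi fun v hv => ?_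
    have hv' : (0 : ℝ) < v := hv
    have e1 : |-(b / a) / v ^ 2| = b / a / v ^ 2 := by
      rw [neg_div, abs_neg, abs_of_pos (by positivity)]
    have e2 : F (b / a / v) = -F v := by
      simp only [hF]; field_simp; ring
    simp only [e1, e2, smul_eq_mul, neg_sq]
    field_simp
  have hsum : Real.sqrt Real.pi = 2 * (a * ∫ v in Ioi (0 : ℝ), Real.exp (-(F v) ^ 2)) := by
    rw [← hI, ← integral_const_mul, two_mul]
    nth_rewrite 1 [← hsymm]
    rw [← integral_add hi2 hi1]
    congr 1
    ext v
    ring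
  rw [hsum, mul_div_mul_left _ _ two_ne_zero, mul_div_cancel_left₀ _ ha.ne']

/-- The Laplace transform of the subordinator at time `t` is `exp (-t √l)`. -/
theorem subord_zero_exp {t l : ℝ} (ht : 0 < t) (hl : 0 ≤ l) :
    subord 0 t (fun v => Real.exp (-l * (v ^ 2)⁻¹)) = Real.exp (-(t * Real.sqrt l)) := by
  have hpi : Real.sqrt Real.pi ≠ 0 := by positivity
  rcases hl.eq_or_lt with rfl | hl
  · have : ∀ v : ℝ, subordKernel 0 t v • Real.exp (-0 * (v ^ 2)⁻¹)
        = (Real.sqrt Real.pi)⁻¹ * t * Real.exp (-(t ^ 2 / 4) * v ^ 2) := by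
      intro v
      rw [subordKernel_zero, smul_eq_mul]
      have e : -(t * v) ^ 2 / 4 = -(t ^ 2 / 4) * v ^ 2 := by ring
      simp [e]
    simp only [subord, this]
    have e : Real.pi / (t ^ 2 / 4) = 4 * Real.pi / t ^ 2 := by field_simp
    have e4 : Real.sqrt 4 = 2 := by
      rw [show (4 : ℝ) = 2 ^ 2 by norm_num]; exact Real.sqrt_sq (by norm_num)
    rw [integral_const_mul, integral_gaussian_Ioi, e, Real.sqrt_div (by positivity),
      Real.sqrt_sq ht.le, Real.sqrt_mul (by norm_num), e4]
    simp
    field_simp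
  · have h := integral_exp_neg_sub_div_sq (a := t / 2) (b := Real.sqrt l) (by positivity)
      (Real.sqrt_pos.2 hl)
    have : EqOn (fun v : ℝ => subordKernel 0 t v • Real.exp (-l * (v ^ 2)⁻¹))
        (fun v => (Real.sqrt Real.pi)⁻¹ * t * Real.exp (-(t * Real.sqrt l)) *
          Real.exp (-(t / 2 * v - Real.sqrt l / v) ^ 2)) (Ioi 0) := by
      intro v hv
      have hv' : v ≠ 0 := (ne_of_gt hv)
      simp only
      rw [subordKernel_zero, smul_eq_mul, mul_assoc, mul_assoc _ (Real.exp (-_)), ← Real.exp_add,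
        ← Real.exp_add]
      congr 2
      field_simp
      linear_combination 16 * Real.sq_sqrt hl.le
    rw [subord, setIntegral_congr_fun measurableSet_Ioi this, integral_const_mul, h]
    field_simp

theorem subordKernel_zero_nonneg {t : ℝ} (ht : 0 < t) (v : ℝ) : 0 ≤ subordKernel 0 t v := by
  rw [subordKernel_zero]; positivity

/-- The law at time `t` of the subordinator that turns the heat semigroup into the Poisson
semigroup: the image of the half-Gaussian density `subordKernel 0 t` under `v ↦ v⁻²`. -/
noncomputable def subordinator (t : ℝ) : Measure ℝ :=
  ((volume.restrict (Ioi 0)).withDensity fun v => ENNReal.ofReal (subordKernel 0 t v)).map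
    fun v => (v ^ 2)⁻¹

theorem ae_subordinator_pos (t : ℝ) : ∀ᵐ x ∂subordinator t, 0 < x := by
  rw [subordinator, ae_map_iff (by fun_prop) measurableSet_Ioi]
  refine (withDensity_absolutelyContinuous _ _).ae_le ?_
  filter_upwards [ae_restrict_mem measurableSet_Ioi] with v hv
  have : (0 : ℝ) < v := hv
  positivity

theorem isFiniteMeasure_subordinator {t : ℝ} (ht : 0 < t) : IsFiniteMeasure (subordinator t) := by
  have : IsFiniteMeasure ((volume.restrict (Ioi 0)).withDensity
      fun v => ENNReal.ofReal (subordKernel 0 t v)) :=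
    isFiniteMeasure_withDensity_ofReal (integrable_subordKernel 0 ht).2
  exact Measure.isFiniteMeasure_map _ _

section Convolution

variable {E : Type*} [NormedAddCommGroup E] [NormedSpace ℝ E]

theorem integral_subordinator {t : ℝ} (ht : 0 < t) {h : ℝ → E} (hm : StronglyMeasurable h) :
    ∫ x, h x ∂subordinator t = subord 0 t fun v => h (v ^ 2)⁻¹ := by
  rw [subordinator, integral_map (by fun_prop) hm.aestronglyMeasurable,
    integral_withDensity_eq_integral_toReal_smul
      (continuous_subordKernel 0 t).measurable.ennreal_ofReal (by simp), subord]
  simp only [ENNReal.toReal_ofReal (subordKernel_zero_nonneg ht _)]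

theorem map_add_subordinator {t s : ℝ} (ht : 0 < t) (hs : 0 < s) :
    ((subordinator t).prod (subordinator s)).map (fun p => p.1 + p.2) = subordinator (t + s) := by
  have := isFiniteMeasure_subordinator ht
  have := isFiniteMeasure_subordinator hs
  have := isFiniteMeasure_subordinator (add_pos ht hs)
  have hL : ∀ {t : ℝ}, 0 < t → ∀ {l : ℝ}, 0 < l →
      ∫ x, Real.exp (-l * x) ∂subordinator t = Real.exp (-(t * Real.sqrt l)) := by
    intro t ht l hl
    rw [integral_subordinator ht (by fun_prop), subord_zero_exp ht hl.le]
  refine ext_of_laplace ?_ ((ae_subordinator_pos _).mono fun x hx => hx.le) fun l hl => ?_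
  · rw [ae_map_iff (by fun_prop) measurableSet_Ici]
    have h1 := Measure.quasiMeasurePreserving_fst (μ := subordinator t) (ν := subordinator s)
      |>.ae (ae_subordinator_pos t)
    have h2 := Measure.quasiMeasurePreserving_snd (μ := subordinator t) (ν := subordinator s)
      |>.ae (ae_subordinator_pos s)
    filter_upwards [h1, h2] with p hp hq using (add_pos hp hq).le
  · rw [integral_map (by fun_prop) (by fun_prop), hL (add_pos ht hs) hl]
    simp only [mul_add, Real.exp_add]
    rw [integral_prod_mul (fun x => Real.exp (-l * x)) (fun y => Real.exp (-l * y)), hL ht hl,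
      hL hs hl, ← Real.exp_add]
    congr 1
    ring

/-- The semigroup law for subordination. -/
theorem subord_subord {t s : ℝ} (ht : 0 < t) (hs : 0 < s) {h : ℝ → E}
    (hm : StronglyMeasurable h) {M : ℝ} (hM : ∀ x, 0 < x → ‖h x‖ ≤ M) :
    subord 0 t (fun v => subord 0 s fun w => h ((v ^ 2)⁻¹ + (w ^ 2)⁻¹))
      = subord 0 (t + s) fun v => h (v ^ 2)⁻¹ := by
  have := isFiniteMeasure_subordinator ht
  have := isFiniteMeasure_subordinator hs
  have hm2 : StronglyMeasurable fun p : ℝ × ℝ => h (p.1 + p.2) :=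
    hm.comp_measurable (by fun_prop)
  have hint : Integrable (fun p : ℝ × ℝ => h (p.1 + p.2))
      ((subordinator t).prod (subordinator s)) := by
    refine Integrable.of_bound hm2.aestronglyMeasurable M ?_
    have h1 := Measure.quasiMeasurePreserving_fst (μ := subordinator t) (ν := subordinator s)
      |>.ae (ae_subordinator_pos t)
    have h2 := Measure.quasiMeasurePreserving_snd (μ := subordinator t) (ν := subordinator s)
      |>.ae (ae_subordinator_pos s)
    filter_upwards [h1, h2] with p hp hq using hM _ (add_pos hp hq)
  rw [← integral_subordinator (add_pos ht hs) hm, ← map_add_subordinator ht hs,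
    integral_map (by fun_prop) hm.aestronglyMeasurable, integral_prod _ hint]
  have : ∀ x, ∫ y, h (x + y) ∂subordinator s = subord 0 s fun w => h (x + (w ^ 2)⁻¹) := fun x =>
    integral_subordinator hs (h := fun y => h (x + y)) (hm.comp_measurable (by fun_prop))
  rw [integral_subordinator ht (h := fun x => ∫ y, h (x + y) ∂subordinator s)
    hm2.integral_prod_right]
  simp only [this]

end Convolution

end Laguerre

/-! ### The one-dimensional Laguerre heat kernel -/

namespace Laguerre

/-- The one-dimensional Laguerre measure on `(0,∞)`. -/
noncomputable def laguerreMeasure₁ (a : ℝ) : Measure ℝ :=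
  (volume.restrict (Ioi 0)).withDensity fun y =>
    ENNReal.ofReal (y ^ a * Real.exp (-y) / Real.Gamma (a + 1))

/-- The one-dimensional Laguerre heat kernel. -/
noncomputable def heatKernel₁ (a t x y : ℝ) : ℝ :=
  Real.Gamma (a + 1) / (1 - Real.exp (-t)) *
    Real.exp (-(Real.exp (-t) / (1 - Real.exp (-t))) * (x + y)) *
    Real.sqrt (Real.exp (-t) * x * y) ^ (-a) *
    besselI a (2 * Real.sqrt (Real.exp (-t) * x * y) / (1 - Real.exp (-t)))

theorem heatKernel_eq_prod {d : ℕ} (α : Fin d → ℝ) (t : ℝ) (x y : Fin d → ℝ) :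
    heatKernel α t x y = ∏ j, heatKernel₁ (α j) t (x j) (y j) := rfl

theorem measurable_besselI (ν : ℝ) : Measurable (besselI ν) := by
  unfold besselI
  exact Measurable.tsum fun m => by fun_prop

theorem measurable_heatKernel₁ (a : ℝ) :
    Measurable fun p : ℝ × ℝ × ℝ => heatKernel₁ a p.1 p.2.1 p.2.2 := by
  unfold heatKernel₁
  have := measurable_besselI a
  fun_prop

theorem measurable_heatKernel {d : ℕ} (α : Fin d → ℝ) :
    Measurable fun p : ℝ × (Fin d → ℝ) × (Fin d → ℝ) => heatKernel α p.1 p.2.1 p.2.2 := by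
  simp only [heatKernel_eq_prod]
  refine Finset.measurable_prod _ fun j _ => ?_
  exact (measurable_heatKernel₁ (α j)).comp
    (g := fun p : ℝ × ℝ × ℝ => heatKernel₁ (α j) p.1 p.2.1 p.2.2)
    (f := fun p : ℝ × (Fin d → ℝ) × (Fin d → ℝ) => (p.1, p.2.1 j, p.2.2 j)) (by fun_prop)

/-- A lower bound for `Γ(m + c)` with which the Bessel series is dominated by an exponential one. -/
theorem Gamma_mul_pow_le {c : ℝ} (hc : 0 < c) (m : ℕ) :
    c ^ m * Real.Gamma c ≤ Real.Gamma (m + c) := by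
  induction m with
  | zero => simp
  | succ m ih =>
    have h : ((m + 1 : ℕ) : ℝ) + c = (m + c) + 1 := by push_cast; ring
    have hm : (0 : ℝ) < m + c := by positivity
    rw [h, Real.Gamma_add_one hm.ne', pow_succ, mul_comm _ c, mul_assoc]
    have : (0 : ℝ) ≤ m := by positivity
    have h2 : 0 ≤ c ^ m * Real.Gamma c := mul_nonneg (by positivity) (Real.Gamma_pos_of_pos hc).le
    exact mul_le_mul (by linarith) ih h2 hm.le

theorem summable_besselI {ν z : ℝ} (hν : -1 < ν) (hz : 0 < z) :
    Summable fun m : ℕ =>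
      (z / 2) ^ (2 * (m : ℝ) + ν) / ((m.factorial : ℝ) * Real.Gamma ((m : ℝ) + ν + 1)) := by
  have hc : 0 < ν + 1 := by linarith
  have hG := Real.Gamma_pos_of_pos hc
  have hz2 : 0 < z / 2 := by positivity
  refine Summable.of_nonneg_of_le (fun m => ?_) (fun m => ?_)
    ((Real.summable_pow_div_factorial ((z / 2) ^ 2 / (ν + 1))).mul_left
      ((z / 2) ^ ν / Real.Gamma (ν + 1)))
  · have : 0 < Real.Gamma ((m : ℝ) + ν + 1) :=
      Real.Gamma_pos_of_pos (by have : (0 : ℝ) ≤ m := by positivity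
                                linarith)
    positivity
  · have h := Gamma_mul_pow_le hc m
    rw [← add_assoc] at h
    rw [Real.rpow_add hz2, Real.rpow_mul hz2.le, Real.rpow_natCast, Real.rpow_two]
    calc _ ≤ ((z / 2) ^ 2) ^ m * (z / 2) ^ ν /
          ((m.factorial : ℝ) * ((ν + 1) ^ m * Real.Gamma (ν + 1))) := by gcongr
      _ = _ := by
          rw [div_pow ((z / 2) ^ 2)]
          field_simp

theorem one_sub_exp_neg_pos {t : ℝ} (ht : 0 < t) : 0 < 1 - Real.exp (-t) := by
  have : Real.exp (-t) < 1 := by simpa using ht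
  linarith

/-- The coefficients of the heat kernel as a power series in `y`, up to the common exponential. -/
noncomputable def heatCoeff (a t x : ℝ) (m : ℕ) : ℝ :=
  Real.Gamma (a + 1) / (1 - Real.exp (-t)) *
    Real.exp (-(Real.exp (-t) / (1 - Real.exp (-t)) * x)) * (Real.exp (-t) * x) ^ m /
    (1 - Real.exp (-t)) ^ (2 * (m : ℝ) + a) / (m.factorial * Real.Gamma (m + a + 1))

theorem Gamma_natCast_add_pos {a : ℝ} (ha : -1 < a) (m : ℕ) : 0 < Real.Gamma (m + a + 1) :=
  Real.Gamma_pos_of_pos (by have : (0 : ℝ) ≤ m := by positivity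
                            linarith)

theorem heatCoeff_nonneg {a t x : ℝ} (ha : -1 < a) (ht : 0 < t) (hx : 0 < x) (m : ℕ) :
    0 ≤ heatCoeff a t x m := by
  have := one_sub_exp_neg_pos ht
  have := Gamma_natCast_add_pos ha m
  have : 0 < Real.Gamma (a + 1) := Real.Gamma_pos_of_pos (by linarith)
  unfold heatCoeff
  positivity

/-- The heat kernel as a power series in `y`. The power `√(r x y)^(-a)` cancels against the leading
power of the Bessel function, which leaves integer powers of `y`. -/
theorem hasSum_heatKernel₁ {a t x y : ℝ} (ha : -1 < a) (ht : 0 < t) (hx : 0 < x) (hy : 0 < y) :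
    HasSum (fun m : ℕ => heatCoeff a t x m * y ^ m *
      Real.exp (-(Real.exp (-t) / (1 - Real.exp (-t)) * y))) (heatKernel₁ a t x y) := by
  have h1 := one_sub_exp_neg_pos ht
  have hw : 0 < Real.exp (-t) * x * y := by positivity
  have hq := Real.sq_sqrt hw.le
  have hq0 := Real.sqrt_pos.2 hw
  have hs := ((summable_besselI ha (z := 2 * Real.sqrt (Real.exp (-t) * x * y) /
    (1 - Real.exp (-t))) (by positivity)).hasSum).mul_left (Real.Gamma (a + 1) /
    (1 - Real.exp (-t)) * Real.exp (-(Real.exp (-t) / (1 - Real.exp (-t))) * (x + y)) *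
    Real.sqrt (Real.exp (-t) * x * y) ^ (-a))
  refine hs.congr_fun fun m => ?_
  set q := Real.sqrt (Real.exp (-t) * x * y)
  set r := Real.exp (-t)
  have e0 : 2 * q / (1 - r) / 2 = q / (1 - r) := by field_simp
  have e1 : Real.exp (-(r / (1 - r)) * (x + y))
      = Real.exp (-(r / (1 - r) * x)) * Real.exp (-(r / (1 - r) * y)) := by
    rw [← Real.exp_add]; congr 1; ring
  have e2 : q ^ (2 * (m : ℝ) + a) = (r * x) ^ m * y ^ m * q ^ a := by
    rw [Real.rpow_add hq0, Real.rpow_mul hq0.le, Real.rpow_natCast, Real.rpow_two, hq, mul_pow]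
  have e3 : q ^ (-a) * q ^ a = 1 := by rw [← Real.rpow_add hq0]; simp
  rw [e0, e1, Real.div_rpow hq0.le h1.le, e2, heatCoeff]
  linear_combination (-(Real.Gamma (a + 1) / (1 - r) * (Real.exp (-(r / (1 - r) * x)) *
    Real.exp (-(r / (1 - r) * y))) * ((r * x) ^ m * y ^ m) / (1 - r) ^ (2 * (m : ℝ) + a) /
    (m.factorial * Real.Gamma (m + a + 1)))) * e3

theorem heatKernel₁_nonneg {a t x y : ℝ} (ha : -1 < a) (ht : 0 < t) (hx : 0 < x) (hy : 0 < y) :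
    0 ≤ heatKernel₁ a t x y :=
  (hasSum_heatKernel₁ ha ht hx hy).nonneg fun m => by
    have := heatCoeff_nonneg ha ht hx m
    positivity

theorem lintegral_rpow_mul_exp_neg {s p : ℝ} (hs : 0 < s) (hp : 0 < p) :
    ∫⁻ y in Ioi (0 : ℝ), ENNReal.ofReal (y ^ (s - 1) * Real.exp (-(p * y)))
      = ENNReal.ofReal ((1 / p) ^ s * Real.Gamma s) := by
  have hG := Real.Gamma_pos_of_pos hs
  have h := Real.integral_rpow_mul_exp_neg_mul_Ioi hs hp
  have hi : IntegrableOn (fun y : ℝ => y ^ (s - 1) * Real.exp (-(p * y))) (Ioi 0) := by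
    by_contra hc
    rw [integral_undef hc] at h
    have : 0 < (1 / p) ^ s * Real.Gamma s := by positivity
    linarith
  rw [← h, ofReal_integral_eq_lintegral_ofReal hi]
  filter_upwards [ae_restrict_mem measurableSet_Ioi] with y hy
  have : (0 : ℝ) < y := hy
  simp only [Pi.zero_apply]
  positivity

theorem hasSum_real_exp (x : ℝ) : HasSum (fun n : ℕ => x ^ n / n.factorial) (Real.exp x) := by
  rw [Real.exp_eq_exp_ℝ]
  exact NormedSpace.expSeries_div_hasSum_exp x

theorem ae_laguerreMeasure₁_pos (a : ℝ) : ∀ᵐ y ∂laguerreMeasure₁ a, 0 < y :=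
  (withDensity_absolutelyContinuous _ _).ae_le (ae_restrict_mem measurableSet_Ioi)

/-- Laplace transform of the heat kernel. Integrating the power series termwise turns the heat
kernel into an exponential series: the heat measure is a Poisson mixture of gamma laws. -/
theorem lintegral_exp_mul_heatKernel₁ {a t x l : ℝ} (ha : -1 < a) (ht : 0 < t) (hx : 0 < x)
    (hl : 0 ≤ l) :
    ∫⁻ y, ENNReal.ofReal (heatKernel₁ a t x y) * ENNReal.ofReal (Real.exp (-l * y))
        ∂laguerreMeasure₁ a
      = ENNReal.ofReal ((1 + l * (1 - Real.exp (-t))) ^ (-(a + 1)) *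
          Real.exp (-(Real.exp (-t) * l / (1 + l * (1 - Real.exp (-t)))) * x)) := by
  have h1 := one_sub_exp_neg_pos ht
  have hG : 0 < Real.Gamma (a + 1) := Real.Gamma_pos_of_pos (by linarith)
  have hK : Measurable fun y => heatKernel₁ a t x y :=
    (measurable_heatKernel₁ a).comp (g := fun p : ℝ × ℝ × ℝ => heatKernel₁ a p.1 p.2.1 p.2.2)
      (f := fun y => (t, x, y)) (by fun_prop)
  rw [laguerreMeasure₁, lintegral_withDensity_eq_lintegral_mul _ (by fun_prop) (by fun_prop)]
  set r := Real.exp (-t) with hr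
  have hr0 : 0 < r := Real.exp_pos _
  set q := 1 + l * (1 - r) with hq
  have hq0 : 0 < q := by positivity
  -- the total exponential rate in `y`: from the measure, the kernel and the test function
  set p := q / (1 - r) with hp
  have hp0 : 0 < p := by positivity
  have hterm : ∀ m : ℕ, 0 ≤ heatCoeff a t x m / Real.Gamma (a + 1) := fun m =>
    div_nonneg (heatCoeff_nonneg ha ht hx m) hG.le
  have step1 : ∀ y ∈ Ioi (0 : ℝ),
      ENNReal.ofReal (y ^ a * Real.exp (-y) / Real.Gamma (a + 1)) *
        (ENNReal.ofReal (heatKernel₁ a t x y) * ENNReal.ofReal (Real.exp (-l * y)))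
      = ∑' m : ℕ, ENNReal.ofReal (heatCoeff a t x m / Real.Gamma (a + 1)) *
          ENNReal.ofReal (y ^ ((m + a + 1) - 1) * Real.exp (-(p * y))) := by
    intro y hy
    have hy' : 0 < y := hy
    have hs := (hasSum_heatKernel₁ ha ht hx hy').mul_left
      (y ^ a * Real.exp (-y) / Real.Gamma (a + 1) * Real.exp (-l * y))
    have e : ∀ m : ℕ, y ^ a * Real.exp (-y) / Real.Gamma (a + 1) * Real.exp (-l * y) *
        (heatCoeff a t x m * y ^ m * Real.exp (-(r / (1 - r) * y)))
        = heatCoeff a t x m / Real.Gamma (a + 1) *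
          (y ^ ((m + a + 1) - 1) * Real.exp (-(p * y))) := by
      intro m
      have e1 : y ^ (((m : ℝ) + a + 1) - 1) = y ^ m * y ^ a := by
        rw [add_sub_cancel_right, Real.rpow_add hy', Real.rpow_natCast]
      have e2 : Real.exp (-(p * y))
          = Real.exp (-y) * Real.exp (-l * y) * Real.exp (-(r / (1 - r) * y)) := by
        rw [← Real.exp_add, ← Real.exp_add, hp, hq]
        congr 1
        field_simp
        ring
      rw [e1, e2]
      ring
    have hm : ∀ m : ℕ, 0 ≤ heatCoeff a t x m / Real.Gamma (a + 1) *
        (y ^ (((m : ℝ) + a + 1) - 1) * Real.exp (-(p * y))) := fun m =>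
      mul_nonneg (hterm m) (by positivity)
    replace hs := hs.congr_fun fun m => (e m).symm
    rw [← ENNReal.ofReal_mul (heatKernel₁_nonneg ha ht hx hy'),
      ← ENNReal.ofReal_mul (by positivity),
      mul_comm (heatKernel₁ a t x y), ← mul_assoc, ← hs.tsum_eq,
      ENNReal.ofReal_tsum_of_nonneg hm hs.summable]
    exact tsum_congr fun m => ENNReal.ofReal_mul (hterm m)
  simp only [Pi.mul_apply]
  rw [setLIntegral_congr_fun measurableSet_Ioi step1, lintegral_tsum fun m => by fun_prop]
  have step2 : ∀ m : ℕ, ∫⁻ y in Ioi (0 : ℝ),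
      ENNReal.ofReal (heatCoeff a t x m / Real.Gamma (a + 1)) *
          ENNReal.ofReal (y ^ (((m : ℝ) + a + 1) - 1) * Real.exp (-(p * y)))
      = ENNReal.ofReal (q ^ (-(a + 1)) * Real.exp (-(r / (1 - r) * x)) *
          ((r * x / ((1 - r) * q)) ^ m / m.factorial)) := by
    intro m
    have hGm := Gamma_natCast_add_pos ha m
    have hm0 : (0 : ℝ) < m + a + 1 := by
      have : (0 : ℝ) ≤ m := by positivity
      linarith
    rw [lintegral_const_mul _ (by fun_prop), lintegral_rpow_mul_exp_neg hm0 hp0,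
      ← ENNReal.ofReal_mul (hterm m)]
    congr 1
    have e1 : (1 / p) ^ ((m : ℝ) + a + 1)
        = (1 - r) ^ m * (1 - r) ^ (a + 1) * (q ^ (-(a + 1)) / q ^ m) := by
      rw [hp, one_div_div, Real.div_rpow h1.le hq0.le, add_assoc, Real.rpow_add h1,
        Real.rpow_add hq0, Real.rpow_natCast, Real.rpow_natCast, Real.rpow_neg hq0.le]
      field_simp
    have e2 : (1 - r) ^ (2 * (m : ℝ) + a) * (1 - r)
        = (1 - r) ^ m * (1 - r) ^ m * (1 - r) ^ (a + 1) := by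
      rw [← Real.rpow_add_one h1.ne', add_assoc, Real.rpow_add h1, Real.rpow_mul h1.le,
        Real.rpow_two, Real.rpow_natCast, ← pow_mul, mul_comm 2 m, pow_mul]
      ring
    have e3 : 0 < (1 - r) ^ (2 * (m : ℝ) + a) := by positivity
    have e4 : 0 < (1 - r) ^ (a + 1) := by positivity
    rw [e1, heatCoeff, ← hr, div_pow, mul_pow (1 - r) q]
    field_simp
    rw [mul_comm (1 - r), e2]
    ring
  simp only [step2]
  have hs := (hasSum_real_exp (r * x / ((1 - r) * q))).mul_left
    (q ^ (-(a + 1)) * Real.exp (-(r / (1 - r) * x)))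
  rw [← ENNReal.ofReal_tsum_of_nonneg (fun m => by positivity) hs.summable, hs.tsum_eq, mul_assoc,
    ← Real.exp_add]
  congr 3
  rw [hq]
  field_simp
  ring

/-- The heat kernel has total mass one. -/
theorem lintegral_heatKernel₁ {a t x : ℝ} (ha : -1 < a) (ht : 0 < t) (hx : 0 < x) :
    ∫⁻ y, ENNReal.ofReal (heatKernel₁ a t x y) ∂laguerreMeasure₁ a = 1 := by
  simpa using lintegral_exp_mul_heatKernel₁ ha ht hx le_rfl

instance (a : ℝ) : SigmaFinite (laguerreMeasure₁ a) := by
  unfold laguerreMeasure₁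
  exact SigmaFinite.withDensity_ofReal _

theorem measurable_heatKernel₁_uncurry (a t : ℝ) :
    Measurable fun p : ℝ × ℝ => heatKernel₁ a t p.1 p.2 :=
  (measurable_heatKernel₁ a).comp (g := fun p : ℝ × ℝ × ℝ => heatKernel₁ a p.1 p.2.1 p.2.2)
    (f := fun p : ℝ × ℝ => (t, p.1, p.2)) (by fun_prop)

/-- The parameters of the Laplace transform of the heat kernel compose under iteration: the
prefactors multiply, see also `laplace_param_comp` for the exponents. -/
theorem laplace_param_mul {r q l : ℝ} (hq : 0 < 1 + l * (1 - q)) :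
    (1 + l * (1 - q)) * (1 + q * l / (1 + l * (1 - q)) * (1 - r)) = 1 + l * (1 - r * q) := by
  field_simp
  ring

theorem laplace_param_comp {r q l : ℝ} (hq : 0 < 1 + l * (1 - q))
    (_ : 0 < 1 + q * l / (1 + l * (1 - q)) * (1 - r)) :
    r * (q * l / (1 + l * (1 - q))) / (1 + q * l / (1 + l * (1 - q)) * (1 - r))
      = r * q * l / (1 + l * (1 - r * q)) := by
  rw [← laplace_param_mul hq]
  field_simp

/-- Chapman–Kolmogorov equation for the one-dimensional heat kernel: both sides have the same
Laplace transform in `z`. -/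
theorem lintegral_heatKernel₁_mul {a t s x : ℝ} (ha : -1 < a) (ht : 0 < t) (hs : 0 < s)
    (hx : 0 < x) :
    ∀ᵐ z ∂laguerreMeasure₁ a,
      ∫⁻ y, ENNReal.ofReal (heatKernel₁ a t x y) * ENNReal.ofReal (heatKernel₁ a s y z)
        ∂laguerreMeasure₁ a = ENNReal.ofReal (heatKernel₁ a (t + s) x z) := by
  have hKt : Measurable fun y => heatKernel₁ a t x y :=
    (measurable_heatKernel₁_uncurry a t).comp measurable_prodMk_left
  have hKts : Measurable fun y => heatKernel₁ a (t + s) x y :=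
    (measurable_heatKernel₁_uncurry a (t + s)).comp measurable_prodMk_left
  have hKs := measurable_heatKernel₁_uncurry a s
  have hKs' : ∀ y, Measurable (heatKernel₁ a s y) := fun y => hKs.comp measurable_prodMk_left
  have hKK : Measurable fun p : ℝ × ℝ =>
      ENNReal.ofReal (heatKernel₁ a t x p.1) * ENNReal.ofReal (heatKernel₁ a s p.1 p.2) :=
    (hKt.comp measurable_fst).ennreal_ofReal.mul hKs.ennreal_ofReal
  have hJ : Measurable fun z => ∫⁻ y, ENNReal.ofReal (heatKernel₁ a t x y) *
      ENNReal.ofReal (heatKernel₁ a s y z) ∂laguerreMeasure₁ a := hKK.lintegral_prod_left'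
  have h1t := one_sub_exp_neg_pos ht
  have h1s := one_sub_exp_neg_pos hs
  have h1ts := one_sub_exp_neg_pos (add_pos ht hs)
  have key : ∀ l : ℝ, 0 ≤ l →
      ∫⁻ z, (∫⁻ y, ENNReal.ofReal (heatKernel₁ a t x y) * ENNReal.ofReal (heatKernel₁ a s y z)
        ∂laguerreMeasure₁ a) * ENNReal.ofReal (Real.exp (-l * z)) ∂laguerreMeasure₁ a
      = ∫⁻ z, ENNReal.ofReal (heatKernel₁ a (t + s) x z) * ENNReal.ofReal (Real.exp (-l * z))
        ∂laguerreMeasure₁ a := by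
    intro l hl
    have hq : 0 < 1 + l * (1 - Real.exp (-s)) := by positivity
    have hl' : 0 ≤ Real.exp (-s) * l / (1 + l * (1 - Real.exp (-s))) := by positivity
    have hr : 0 < 1 + Real.exp (-s) * l / (1 + l * (1 - Real.exp (-s))) * (1 - Real.exp (-t)) := by
      positivity
    have hexp : Measurable fun z : ℝ => ENNReal.ofReal (Real.exp (-l * z)) := by fun_prop
    have hKKz : ∀ z, Measurable fun y =>
        ENNReal.ofReal (heatKernel₁ a t x y) * ENNReal.ofReal (heatKernel₁ a s y z) := fun z =>
      hKt.ennreal_ofReal.mul (hKs.comp measurable_prodMk_right).ennreal_ofReal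
    have hKKe : Measurable fun p : ℝ × ℝ => ENNReal.ofReal (heatKernel₁ a t x p.2) *
        ENNReal.ofReal (heatKernel₁ a s p.2 p.1) * ENNReal.ofReal (Real.exp (-l * p.1)) :=
      (hKK.comp measurable_swap).mul (hexp.comp measurable_fst)
    calc _ = ∫⁻ z, ∫⁻ y, ENNReal.ofReal (heatKernel₁ a t x y) *
          ENNReal.ofReal (heatKernel₁ a s y z) * ENNReal.ofReal (Real.exp (-l * z))
            ∂laguerreMeasure₁ a ∂laguerreMeasure₁ a := by
          exact lintegral_congr fun z => (lintegral_mul_const _ (hKKz z)).symm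
      _ = ∫⁻ y, ∫⁻ z, ENNReal.ofReal (heatKernel₁ a t x y) *
          ENNReal.ofReal (heatKernel₁ a s y z) * ENNReal.ofReal (Real.exp (-l * z))
            ∂laguerreMeasure₁ a ∂laguerreMeasure₁ a := by
          exact lintegral_lintegral_swap hKKe.aemeasurable
      _ = ∫⁻ y, ENNReal.ofReal ((1 + l * (1 - Real.exp (-s))) ^ (-(a + 1))) *
          (ENNReal.ofReal (heatKernel₁ a t x y) * ENNReal.ofReal (Real.exp
            (-(Real.exp (-s) * l / (1 + l * (1 - Real.exp (-s)))) * y))) ∂laguerreMeasure₁ a := by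
          refine lintegral_congr_ae ?_
          filter_upwards [ae_laguerreMeasure₁_pos a] with y hy
          have h := lintegral_const_mul (μ := laguerreMeasure₁ a)
            (ENNReal.ofReal (heatKernel₁ a t x y)) ((hKs' y).ennreal_ofReal.mul hexp)
          simp only [Pi.mul_apply, ← mul_assoc] at h
          rw [h, lintegral_exp_mul_heatKernel₁ ha hs hy hl,
            ENNReal.ofReal_mul (Real.rpow_pos_of_pos hq _).le]
          ring
      _ = _ := by
          have e : Real.exp (-(t + s)) = Real.exp (-t) * Real.exp (-s) := by
            rw [← Real.exp_add]; congr 1; ring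
          have hexp' : Measurable fun y : ℝ => ENNReal.ofReal (Real.exp
            (-(Real.exp (-s) * l / (1 + l * (1 - Real.exp (-s)))) * y)) := by fun_prop
          have h := lintegral_const_mul (μ := laguerreMeasure₁ a)
            (ENNReal.ofReal ((1 + l * (1 - Real.exp (-s))) ^ (-(a + 1))))
            (hKt.ennreal_ofReal.mul hexp')
          simp only [Pi.mul_apply] at h
          rw [h, lintegral_exp_mul_heatKernel₁ ha ht hx hl',
            lintegral_exp_mul_heatKernel₁ ha (add_pos ht hs) hx hl,
            ← ENNReal.ofReal_mul (Real.rpow_pos_of_pos hq _).le, ← mul_assoc,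
            ← Real.mul_rpow hq.le hr.le, laplace_param_mul hq, laplace_param_comp hq hr, e]
  have hmass : ∫⁻ z, ENNReal.ofReal (heatKernel₁ a (t + s) x z) ∂laguerreMeasure₁ a = 1 :=
    lintegral_heatKernel₁ ha (add_pos ht hs) hx
  have hmass' : ∫⁻ z, (∫⁻ y, ENNReal.ofReal (heatKernel₁ a t x y) *
      ENNReal.ofReal (heatKernel₁ a s y z) ∂laguerreMeasure₁ a) ∂laguerreMeasure₁ a = 1 := by
    simpa [hmass] using key 0 le_rfl
  refine (withDensity_eq_iff hJ.aemeasurable hKts.ennreal_ofReal.aemeasurable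
    (by rw [hmass']; exact ENNReal.one_ne_top)).1 ?_
  have := isFiniteMeasure_withDensity (μ := laguerreMeasure₁ a)
    (by rw [hmass]; exact ENNReal.one_ne_top)
  have := isFiniteMeasure_withDensity (μ := laguerreMeasure₁ a)
    (by rw [hmass']; exact ENNReal.one_ne_top)
  have hpos := (ae_laguerreMeasure₁_pos a).mono fun y hy => hy.le
  refine ext_of_laplace ((withDensity_absolutelyContinuous _ _).ae_le hpos)
    ((withDensity_absolutelyContinuous _ _).ae_le hpos) fun l hl => ?_
  have hexp : Measurable fun z : ℝ => ENNReal.ofReal (Real.exp (-l * z)) := by fun_prop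
  rw [integral_eq_lintegral_of_nonneg_ae (Filter.Eventually.of_forall fun z => (Real.exp_pos _).le)
      (by fun_prop),
    integral_eq_lintegral_of_nonneg_ae (Filter.Eventually.of_forall fun z => (Real.exp_pos _).le)
      (by fun_prop),
    lintegral_withDensity_eq_lintegral_mul _ hJ hexp,
    lintegral_withDensity_eq_lintegral_mul _ hKts.ennreal_ofReal hexp]
  simp only [Pi.mul_apply]
  rw [key l hl.le]

end Laguerre

/-! ### The Laguerre heat semigroup -/

namespace Laguerre

theorem isFiniteMeasure_laguerreMeasure₁ {a : ℝ} (ha : -1 < a) :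
    IsFiniteMeasure (laguerreMeasure₁ a) ∧
      IntegrableOn (fun y : ℝ => y ^ a * Real.exp (-y) / Real.Gamma (a + 1)) (Ioi 0) := by
  have hi : IntegrableOn (fun y : ℝ => y ^ a * Real.exp (-y) / Real.Gamma (a + 1)) (Ioi 0) := by
    refine IntegrableOn.congr_fun ((Real.GammaIntegral_convergent (s := a + 1)
      (by linarith)).div_const (Real.Gamma (a + 1))) (fun y _ => ?_) measurableSet_Ioi
    simp only [add_sub_cancel_right]
    ring
  exact ⟨isFiniteMeasure_withDensity_ofReal hi.2, hi⟩

section Multidim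

variable {d : ℕ} {α : Fin d → ℝ}

instance (α : Fin d → ℝ) : SigmaFinite (laguerreMeasure α) := by
  unfold laguerreMeasure
  exact SigmaFinite.withDensity_ofReal _

theorem measurableSet_posOrthant (d : ℕ) : MeasurableSet (posOrthant d) := by
  have : posOrthant d = univ.pi fun _ => Ioi (0 : ℝ) := by ext x; simp [posOrthant]
  rw [this]
  exact MeasurableSet.univ_pi fun _ => measurableSet_Ioi

theorem ae_mem_posOrthant (α : Fin d → ℝ) : ∀ᵐ y ∂laguerreMeasure α, y ∈ posOrthant d :=
  (withDensity_absolutelyContinuous _ _).ae_le (ae_restrict_mem (measurableSet_posOrthant d))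

/-- The Laguerre measure is the product of its one-dimensional factors. -/
theorem laguerreMeasure_eq_pi (hα : ∀ i, -1 < α i) :
    laguerreMeasure α = Measure.pi fun j => laguerreMeasure₁ (α j) := by
  set g : Fin d → ℝ → ℝ := fun i y => y ^ α i * Real.exp (-y) / Real.Gamma (α i + 1) with hg
  refine (Measure.pi_eq fun s hs => ?_).symm
  have hi : ∀ i, Integrable (g i) ((volume.restrict (Ioi 0)).restrict (s i)) := fun i =>
    (isFiniteMeasure_laguerreMeasure₁ (hα i)).2.integrable.integrableOn
  have hres : (volume.restrict (posOrthant d)).restrict (univ.pi s)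
      = Measure.pi fun i => (volume.restrict (Ioi (0 : ℝ))).restrict (s i) := by
    have : posOrthant d = univ.pi fun _ => Ioi (0 : ℝ) := by ext x; simp [posOrthant]
    rw [this, volume_pi, Measure.restrict_pi_pi, Measure.restrict_pi_pi]
  have hpos : ∀ i, ∀ᵐ y ∂((volume.restrict (Ioi (0 : ℝ))).restrict (s i)), 0 ≤ g i y := by
    intro i
    filter_upwards [ae_restrict_of_ae (ae_restrict_mem measurableSet_Ioi)] with y hy
    have : (0 : ℝ) < y := hy
    have : 0 < Real.Gamma (α i + 1) := Real.Gamma_pos_of_pos (by linarith [hα i])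
    simp only [hg]
    positivity
  have hpos' : ∀ᵐ x ∂Measure.pi fun i => (volume.restrict (Ioi (0 : ℝ))).restrict (s i),
      0 ≤ ∏ i, g i (x i) := by
    have : ∀ᵐ x ∂Measure.pi fun i => (volume.restrict (Ioi (0 : ℝ))).restrict (s i),
        ∀ i, 0 ≤ g i (x i) :=
      ae_all_iff.2 fun i => (Measure.tendsto_eval_ae_ae
        (μ := fun i => (volume.restrict (Ioi (0 : ℝ))).restrict (s i)) (i := i)).eventually (hpos i)
    exact this.mono fun x hx => Finset.prod_nonneg fun i _ => hx i
  rw [laguerreMeasure, withDensity_apply _ (MeasurableSet.univ_pi hs), hres,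
    ← ofReal_integral_eq_lintegral_ofReal (f := fun x : Fin d → ℝ => ∏ i, g i (x i))
      (Integrable.fintype_prod hi) hpos', integral_fintype_prod_eq_prod,
    ENNReal.ofReal_prod_of_nonneg fun i _ => integral_nonneg_of_ae (hpos i)]
  refine Finset.prod_congr rfl fun i _ => ?_
  rw [laguerreMeasure₁, withDensity_apply _ (hs i),
    ofReal_integral_eq_lintegral_ofReal (hi i) (hpos i)]

theorem heatKernel_nonneg (hα : ∀ i, -1 < α i) {t : ℝ} (ht : 0 < t) {x y : Fin d → ℝ}
    (hx : x ∈ posOrthant d) (hy : y ∈ posOrthant d) : 0 ≤ heatKernel α t x y :=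
  Finset.prod_nonneg fun j _ => heatKernel₁_nonneg (hα j) ht (hx j) (hy j)

theorem integrable_heatKernel₁ {a t x : ℝ} (ha : -1 < a) (ht : 0 < t) (hx : 0 < x) :
    Integrable (heatKernel₁ a t x) (laguerreMeasure₁ a) ∧
      ∫ y, heatKernel₁ a t x y ∂laguerreMeasure₁ a = 1 := by
  have hm : Measurable (heatKernel₁ a t x) :=
    (measurable_heatKernel₁_uncurry a t).comp measurable_prodMk_left
  have h0 : 0 ≤ᵐ[laguerreMeasure₁ a] heatKernel₁ a t x :=
    (ae_laguerreMeasure₁_pos a).mono fun y hy => heatKernel₁_nonneg ha ht hx hy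
  have h1 := lintegral_heatKernel₁ ha ht hx
  refine ⟨⟨hm.aestronglyMeasurable, ?_⟩, ?_⟩
  · rw [hasFiniteIntegral_iff_ofReal h0, h1]
    exact ENNReal.one_lt_top
  · rw [integral_eq_lintegral_of_nonneg_ae h0 hm.aestronglyMeasurable, h1, ENNReal.toReal_one]

theorem integral_heatKernel₁_mul {a t s x : ℝ} (ha : -1 < a) (ht : 0 < t) (hs : 0 < s)
    (hx : 0 < x) :
    ∀ᵐ z ∂laguerreMeasure₁ a, ∫ y, heatKernel₁ a t x y * heatKernel₁ a s y z
        ∂laguerreMeasure₁ a = heatKernel₁ a (t + s) x z := by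
  filter_upwards [lintegral_heatKernel₁_mul ha ht hs hx, ae_laguerreMeasure₁_pos a] with z hz hz0
  have hm : Measurable fun y => heatKernel₁ a t x y * heatKernel₁ a s y z :=
    ((measurable_heatKernel₁_uncurry a t).comp measurable_prodMk_left).mul
      ((measurable_heatKernel₁_uncurry a s).comp measurable_prodMk_right)
  rw [integral_eq_lintegral_of_nonneg_ae ((ae_laguerreMeasure₁_pos a).mono fun y hy =>
    mul_nonneg (heatKernel₁_nonneg ha ht hx hy) (heatKernel₁_nonneg ha hs hy hz0))
    hm.aestronglyMeasurable]
  rw [← ENNReal.toReal_ofReal (heatKernel₁_nonneg ha (add_pos ht hs) hx hz0), ← hz]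
  congr 1
  refine lintegral_congr_ae ((ae_laguerreMeasure₁_pos a).mono fun y hy => ?_)
  exact ENNReal.ofReal_mul (heatKernel₁_nonneg ha ht hx hy)

theorem integrable_heatKernel (hα : ∀ i, -1 < α i) {t : ℝ} (ht : 0 < t) {x : Fin d → ℝ}
    (hx : x ∈ posOrthant d) : Integrable (heatKernel α t x) (laguerreMeasure α) := by
  rw [laguerreMeasure_eq_pi hα]
  exact Integrable.fintype_prod fun j => (integrable_heatKernel₁ (hα j) ht (hx j)).1

theorem integral_heatKernel (hα : ∀ i, -1 < α i) {t : ℝ} (ht : 0 < t) {x : Fin d → ℝ}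
    (hx : x ∈ posOrthant d) : ∫ y, heatKernel α t x y ∂laguerreMeasure α = 1 := by
  rw [laguerreMeasure_eq_pi hα]
  simp only [heatKernel_eq_prod]
  rw [integral_fintype_prod_eq_prod]
  exact Finset.prod_eq_one fun j _ => (integrable_heatKernel₁ (hα j) ht (hx j)).2

/-- Chapman–Kolmogorov equation for the Laguerre heat kernel. -/
theorem integral_heatKernel_mul (hα : ∀ i, -1 < α i) {t s : ℝ} (ht : 0 < t) (hs : 0 < s)
    {x : Fin d → ℝ} (hx : x ∈ posOrthant d) :
    ∀ᵐ z ∂laguerreMeasure α, ∫ y, heatKernel α t x y * heatKernel α s y z ∂laguerreMeasure α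
      = heatKernel α (t + s) x z := by
  rw [laguerreMeasure_eq_pi hα]
  have : ∀ᵐ z ∂Measure.pi fun j => laguerreMeasure₁ (α j), ∀ j,
      ∫ y, heatKernel₁ (α j) t (x j) y * heatKernel₁ (α j) s y (z j) ∂laguerreMeasure₁ (α j)
        = heatKernel₁ (α j) (t + s) (x j) (z j) :=
    ae_all_iff.2 fun j => (Measure.tendsto_eval_ae_ae
      (μ := fun j => laguerreMeasure₁ (α j)) (i := j)).eventually
      (integral_heatKernel₁_mul (hα j) ht hs (hx j))
  filter_upwards [this] with z hz
  simp only [heatKernel_eq_prod, ← Finset.prod_mul_distrib]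
  rw [integral_fintype_prod_eq_prod (fun j y =>
    heatKernel₁ (α j) t (x j) y * heatKernel₁ (α j) s y (z j))]
  exact Finset.prod_congr rfl fun j _ => hz j

variable {𝕜 : Type*} [RCLike 𝕜]

theorem heatSemigroup_of_pos {t : ℝ} (ht : 0 < t) (f : (Fin d → ℝ) → 𝕜) (x : Fin d → ℝ) :
    heatSemigroup α t f x = ∫ y, heatKernel α t x y • f y ∂laguerreMeasure α :=
  if_neg ht.ne'

theorem heatSemigroup_congr_ae {t : ℝ} (ht : 0 < t) {f g : (Fin d → ℝ) → 𝕜}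
    (h : f =ᵐ[laguerreMeasure α] g) (x : Fin d → ℝ) :
    heatSemigroup α t f x = heatSemigroup α t g x := by
  rw [heatSemigroup_of_pos ht, heatSemigroup_of_pos ht]
  exact integral_congr_ae (h.mono fun y hy => by simp only [hy])

theorem norm_heatSemigroup_le (hα : ∀ i, -1 < α i) {t : ℝ} (ht : 0 < t) {x : Fin d → ℝ}
    (hx : x ∈ posOrthant d) {f : (Fin d → ℝ) → 𝕜} {M : ℝ}
    (hM : ∀ᵐ y ∂laguerreMeasure α, ‖f y‖ ≤ M) : ‖heatSemigroup α t f x‖ ≤ M := by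
  rw [heatSemigroup_of_pos ht]
  calc _ ≤ ∫ y, heatKernel α t x y * M ∂laguerreMeasure α := by
        refine norm_integral_le_of_norm_le ((integrable_heatKernel hα ht hx).mul_const M) ?_
        filter_upwards [hM, ae_mem_posOrthant α] with y hy hy'
        have h0 := heatKernel_nonneg hα ht hx hy'
        rw [norm_smul, Real.norm_of_nonneg h0]
        exact mul_le_mul_of_nonneg_left hy h0
    _ = M := by rw [integral_mul_const, integral_heatKernel hα ht hx, one_mul]

theorem stronglyMeasurable_heatSemigroup {f : (Fin d → ℝ) → 𝕜} (hf : StronglyMeasurable f) :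
    StronglyMeasurable fun p : ℝ × (Fin d → ℝ) => heatSemigroup α p.1 f p.2 := by
  unfold heatSemigroup
  refine StronglyMeasurable.ite (measurableSet_eq_fun measurable_fst measurable_const)
    (hf.comp_measurable measurable_snd) ?_
  refine StronglyMeasurable.integral_prod_right' (f := fun q : (ℝ × (Fin d → ℝ)) × (Fin d → ℝ) =>
    heatKernel α q.1.1 q.1.2 q.2 • f q.2) ?_
  refine StronglyMeasurable.smul ?_ (hf.comp_measurable measurable_snd)
  exact ((measurable_heatKernel α).comp
    (f := fun q : (ℝ × (Fin d → ℝ)) × (Fin d → ℝ) => (q.1.1, q.1.2, q.2))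
    (by fun_prop)).stronglyMeasurable

theorem measurable_heatKernel_uncurry (α : Fin d → ℝ) (t : ℝ) :
    Measurable fun p : (Fin d → ℝ) × (Fin d → ℝ) => heatKernel α t p.1 p.2 :=
  (measurable_heatKernel α).comp
    (f := fun p : (Fin d → ℝ) × (Fin d → ℝ) => (t, p.1, p.2)) (by fun_prop)

theorem integrable_heatKernel_mul (hα : ∀ i, -1 < α i) {t s : ℝ} (ht : 0 < t) (hs : 0 < s)
    {x : Fin d → ℝ} (hx : x ∈ posOrthant d) :
    Integrable (fun p : (Fin d → ℝ) × (Fin d → ℝ) => heatKernel α t x p.1 * heatKernel α s p.1 p.2)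
      ((laguerreMeasure α).prod (laguerreMeasure α)) := by
  have hm : Measurable fun p : (Fin d → ℝ) × (Fin d → ℝ) =>
      heatKernel α t x p.1 * heatKernel α s p.1 p.2 :=
    (((measurable_heatKernel_uncurry α t).comp measurable_prodMk_left).comp measurable_fst).mul
      (measurable_heatKernel_uncurry α s)
  refine (integrable_prod_iff hm.aestronglyMeasurable).2 ⟨?_, ?_⟩
  · filter_upwards [ae_mem_posOrthant α] with y hy
    exact (integrable_heatKernel hα hs hy).const_mul _
  · refine (integrable_heatKernel hα ht hx).congr ?_
    filter_upwards [ae_mem_posOrthant α] with y hy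
    have h0 := heatKernel_nonneg hα ht hx hy
    have : ∀ᵐ z ∂laguerreMeasure α, ‖heatKernel α t x y * heatKernel α s y z‖
        = heatKernel α t x y * heatKernel α s y z := by
      filter_upwards [ae_mem_posOrthant α] with z hz
      exact Real.norm_of_nonneg (mul_nonneg h0 (heatKernel_nonneg hα hs hy hz))
    rw [integral_congr_ae this, integral_const_mul, integral_heatKernel hα hs hy, mul_one]

/-- The semigroup law of the Laguerre heat semigroup on bounded functions. -/
theorem heatSemigroup_heatSemigroup (hα : ∀ i, -1 < α i) {t s : ℝ} (ht : 0 < t) (hs : 0 < s)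
    {x : Fin d → ℝ} (hx : x ∈ posOrthant d) {f : (Fin d → ℝ) → 𝕜} (hf : StronglyMeasurable f)
    {M : ℝ} (hM : ∀ᵐ y ∂laguerreMeasure α, ‖f y‖ ≤ M) :
    heatSemigroup α t (heatSemigroup α s f) x = heatSemigroup α (t + s) f x := by
  have hint : Integrable (Function.uncurry fun y z : Fin d → ℝ =>
      (heatKernel α t x y * heatKernel α s y z) • f z)
      ((laguerreMeasure α).prod (laguerreMeasure α)) := by
    have hK := integrable_heatKernel_mul hα ht hs hx
    refine (hK.norm.mul_const M).mono'
      (hK.aestronglyMeasurable.smul (hf.comp_measurable measurable_snd).aestronglyMeasurable) ?_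
    have h2 := Measure.quasiMeasurePreserving_snd (μ := laguerreMeasure α)
      (ν := laguerreMeasure α) |>.ae hM
    filter_upwards [h2] with p hp
    rw [Function.uncurry, norm_smul]
    exact mul_le_mul_of_nonneg_left hp (norm_nonneg _)
  rw [heatSemigroup_of_pos ht, heatSemigroup_of_pos (add_pos ht hs)]
  calc _ = ∫ y, ∫ z, (heatKernel α t x y * heatKernel α s y z) • f z
        ∂laguerreMeasure α ∂laguerreMeasure α := by
        refine integral_congr_ae (Filter.Eventually.of_forall fun y => ?_)
        simp only [heatSemigroup_of_pos hs, mul_smul, integral_smul]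
    _ = ∫ z, ∫ y, (heatKernel α t x y * heatKernel α s y z) • f z
        ∂laguerreMeasure α ∂laguerreMeasure α := integral_integral_swap hint
    _ = _ := by
        refine integral_congr_ae ?_
        filter_upwards [integral_heatKernel_mul hα ht hs hx] with z hz
        rw [integral_smul_const, hz]

end Multidim

end Laguerre

/-! ### Derivatives of the Poisson–Laguerre semigroup -/

namespace Laguerre

section Commutation

variable {E : Type*} [NormedAddCommGroup E] [NormedSpace ℝ E]

theorem subord_comm (k l : ℕ) {t s : ℝ} (ht : 0 < t) (hs : 0 < s) {H : ℝ → ℝ → E}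
    (hm : StronglyMeasurable (Function.uncurry H)) {M : ℝ}
    (hM : ∀ v w, 0 < v → 0 < w → ‖H v w‖ ≤ M) :
    subord k t (fun v => subord l s fun w => H v w)
      = subord l s (fun w => subord k t fun v => H v w) := by
  have hint : Integrable (Function.uncurry fun v w : ℝ =>
      (subordKernel k t v * subordKernel l s w) • H v w)
      ((volume.restrict (Ioi 0)).prod (volume.restrict (Ioi 0))) := by
    have hK : Integrable (fun p : ℝ × ℝ => subordKernel k t p.1 * subordKernel l s p.2)
        ((volume.restrict (Ioi 0)).prod (volume.restrict (Ioi 0))) :=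
      (integrable_subordKernel k ht).integrable.mul_prod (integrable_subordKernel l hs).integrable
    refine (hK.norm.mul_const M).mono' (hK.aestronglyMeasurable.smul hm.aestronglyMeasurable) ?_
    have h1 := Measure.quasiMeasurePreserving_fst (μ := volume.restrict (Ioi (0 : ℝ)))
      (ν := volume.restrict (Ioi (0 : ℝ))) |>.ae (ae_restrict_mem measurableSet_Ioi)
    have h2 := Measure.quasiMeasurePreserving_snd (μ := volume.restrict (Ioi (0 : ℝ)))
      (ν := volume.restrict (Ioi (0 : ℝ))) |>.ae (ae_restrict_mem measurableSet_Ioi)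
    filter_upwards [h1, h2] with p hp hq
    rw [Function.uncurry, norm_smul]
    exact mul_le_mul_of_nonneg_left (hM _ _ hp hq) (norm_nonneg _)
  calc _ = ∫ v in Ioi (0 : ℝ), ∫ w in Ioi (0 : ℝ),
        (subordKernel k t v * subordKernel l s w) • H v w := by
        simp only [subord, mul_smul, integral_smul]
    _ = ∫ w in Ioi (0 : ℝ), ∫ v in Ioi (0 : ℝ),
        (subordKernel k t v * subordKernel l s w) • H v w := integral_integral_swap hint
    _ = _ := by
        simp only [subord, mul_comm (subordKernel k t _), mul_smul, integral_smul]

/-- The `k`-th derivative in `s` of the semigroup law `subord_subord`. -/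
theorem subord_zero_subord (k : ℕ) {t s : ℝ} (ht : 0 < t) (hs : 0 < s) {h : ℝ → E}
    (hm : StronglyMeasurable h) {M : ℝ} (hM : ∀ x, 0 < x → ‖h x‖ ≤ M) :
    subord 0 t (fun v => subord k s fun w => h ((v ^ 2)⁻¹ + (w ^ 2)⁻¹))
      = subord k (t + s) fun v => h (v ^ 2)⁻¹ := by
  have hM' : ∀ v w : ℝ, 0 < v → 0 < w → ‖h ((v ^ 2)⁻¹ + (w ^ 2)⁻¹)‖ ≤ M := fun v w hv hw =>
    hM _ (by positivity)
  have hm2 : StronglyMeasurable (Function.uncurry fun v w : ℝ => h ((v ^ 2)⁻¹ + (w ^ 2)⁻¹)) :=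
    hm.comp_measurable (by fun_prop)
  have hM0 : 0 ≤ M := (norm_nonneg _).trans (hM 1 one_pos)
  have hm1 : StronglyMeasurable fun v => h (v ^ 2)⁻¹ := hm.comp_measurable (by fun_prop)
  have hM1 : ∀ v : ℝ, 0 < v → ‖h (v ^ 2)⁻¹‖ ≤ M := fun v hv => hM _ (by positivity)
  obtain ⟨C, hC, hb⟩ := exists_norm_subord_le 0
  have hIm : StronglyMeasurable fun w => subord 0 t fun v => h ((v ^ 2)⁻¹ + (w ^ 2)⁻¹) := by
    refine StronglyMeasurable.integral_prod_right
      (f := fun w v : ℝ => subordKernel 0 t v • h ((v ^ 2)⁻¹ + (w ^ 2)⁻¹)) ?_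
    exact ((continuous_subordKernel 0 t).stronglyMeasurable.comp_measurable measurable_snd).smul
      (hm.comp_measurable (by fun_prop))
  rw [subord_comm 0 k ht hs hm2 hM']
  induction k generalizing s with
  | zero => rw [← subord_comm 0 0 ht hs hm2 hM', subord_subord ht hs hm hM]
  | succ k ih =>
    have h1 := hasDerivAt_subord k hs hIm.aestronglyMeasurable
      (fun w hw => hb t ht _ M hM0 fun v hv => hM' v w hv hw)
    have h2 : HasDerivAt (fun s => subord k (t + s) fun v => h (v ^ 2)⁻¹)
        (subord (k + 1) (t + s) fun v => h (v ^ 2)⁻¹) s :=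
      (hasDerivAt_subord k (add_pos ht hs) hm1.aestronglyMeasurable hM1).comp_const_add t s
    refine h1.unique (h2.congr_of_eventuallyEq ?_)
    filter_upwards [Ioi_mem_nhds hs] with s' hs' using ih hs'

end Commutation

variable {𝕜 : Type*} [RCLike 𝕜] {d : ℕ} {α : Fin d → ℝ}

/-- The Poisson semigroup as a subordinated average, by the substitution `u = (t v)² / 4`. -/
theorem poissonSemigroup_eq_subord {t : ℝ} (ht : 0 < t) (f : (Fin d → ℝ) → 𝕜) (x : Fin d → ℝ) :
    poissonSemigroup α t f x = subord 0 t fun v => heatSemigroup α (v ^ 2)⁻¹ f x := by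
  have himg : (fun v : ℝ => (t * v) ^ 2 / 4) '' Ioi 0 = Ioi 0 := by
    ext w
    constructor
    · rintro ⟨v, hv, rfl⟩
      have : (0 : ℝ) < v := hv
      exact mem_Ioi.2 (by positivity)
    · intro hw
      have hw' : (0 : ℝ) < w := hw
      refine ⟨2 * Real.sqrt w / t, mem_Ioi.2 (by positivity), ?_⟩
      have := Real.sq_sqrt hw'.le
      simp only
      field_simp
      linarith
  have hd : ∀ v ∈ Ioi (0 : ℝ),
      HasDerivWithinAt (fun v : ℝ => (t * v) ^ 2 / 4) (t ^ 2 * v / 2) (Ioi 0) v := by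
    intro v _
    have h := ((((hasDerivAt_id v).const_mul t).pow 2).div_const 4)
    refine (h.congr_deriv ?_).hasDerivWithinAt
    simp
    ring
  have hinj : InjOn (fun v : ℝ => (t * v) ^ 2 / 4) (Ioi 0) := by
    intro a ha b hb hab
    have ha' : (0 : ℝ) < a := ha
    have hb' : (0 : ℝ) < b := hb
    have h : (t * a) ^ 2 = (t * b) ^ 2 := by simp only at hab; linarith
    have := (pow_left_inj₀ (by positivity) (by positivity) two_ne_zero).1 h
    exact mul_left_cancel₀ ht.ne' this
  have h := integral_image_eq_integral_abs_deriv_smul measurableSet_Ioi hd hinj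
    (fun u => (Real.exp (-u) / Real.sqrt u) • heatSemigroup α (t ^ 2 / (4 * u)) f x)
  rw [himg] at h
  rw [poissonSemigroup, h, subord, ← integral_smul]
  refine setIntegral_congr_fun measurableSet_Ioi fun v hv => ?_
  have hv' : (0 : ℝ) < v := hv
  have e1 : t ^ 2 / (4 * ((t * v) ^ 2 / 4)) = (v ^ 2)⁻¹ := by field_simp
  have e2 : Real.sqrt ((t * v) ^ 2 / 4) = t * v / 2 := by
    rw [show (t * v) ^ 2 / 4 = (t * v / 2) ^ 2 by ring]
    exact Real.sqrt_sq (by positivity)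
  have e3 : |t ^ 2 * v / 2| = t ^ 2 * v / 2 := abs_of_pos (by positivity)
  simp only [e1, e2, e3, smul_smul]
  congr 1
  rw [subordKernel_zero, neg_div]
  field_simp

/-- The `k`-th time derivative of the Poisson semigroup (see `iteratedDeriv_poissonSemigroup`). -/
noncomputable def poissonDeriv (α : Fin d → ℝ) (k : ℕ) (t : ℝ) (f : (Fin d → ℝ) → 𝕜)
    (x : Fin d → ℝ) : 𝕜 :=
  subord k t fun v => heatSemigroup α (v ^ 2)⁻¹ f x

theorem stronglyMeasurable_heatSemigroup_time {f : (Fin d → ℝ) → 𝕜} (hf : StronglyMeasurable f)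
    (x : Fin d → ℝ) : StronglyMeasurable fun t => heatSemigroup α t f x :=
  (stronglyMeasurable_heatSemigroup hf).comp_measurable
    (g := fun t : ℝ => (t, x)) (by fun_prop)

theorem stronglyMeasurable_heatSemigroup_inv {f : (Fin d → ℝ) → 𝕜} (hf : StronglyMeasurable f)
    (x : Fin d → ℝ) : StronglyMeasurable fun v : ℝ => heatSemigroup α (v ^ 2)⁻¹ f x :=
  (stronglyMeasurable_heatSemigroup_time hf x).comp_measurable
    (g := fun v : ℝ => (v ^ 2)⁻¹) (by fun_prop)

theorem stronglyMeasurable_poissonDeriv {f : (Fin d → ℝ) → 𝕜} (hf : StronglyMeasurable f) (k : ℕ)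
    (t : ℝ) : StronglyMeasurable (poissonDeriv α k t f) := by
  refine StronglyMeasurable.integral_prod_right
    (f := fun (x : Fin d → ℝ) (v : ℝ) => subordKernel k t v • heatSemigroup α (v ^ 2)⁻¹ f x) ?_
  refine ((continuous_subordKernel k t).stronglyMeasurable.comp_measurable measurable_snd).smul ?_
  exact (stronglyMeasurable_heatSemigroup hf).comp_measurable
    (g := fun p : (Fin d → ℝ) × ℝ => ((p.2 ^ 2)⁻¹, p.1)) (by fun_prop)

theorem norm_heatSemigroup_inv_le (hα : ∀ i, -1 < α i) {x : Fin d → ℝ} (hx : x ∈ posOrthant d)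
    {f : (Fin d → ℝ) → 𝕜} {M : ℝ} (hM : ∀ᵐ y ∂laguerreMeasure α, ‖f y‖ ≤ M) (v : ℝ) (hv : 0 < v) :
    ‖heatSemigroup α (v ^ 2)⁻¹ f x‖ ≤ M :=
  norm_heatSemigroup_le hα (by positivity) hx hM

theorem hasDerivAt_poissonDeriv (hα : ∀ i, -1 < α i) (k : ℕ) {t : ℝ} (ht : 0 < t) {x : Fin d → ℝ}
    (hx : x ∈ posOrthant d) {f : (Fin d → ℝ) → 𝕜} (hf : StronglyMeasurable f) {M : ℝ}
    (hM : ∀ᵐ y ∂laguerreMeasure α, ‖f y‖ ≤ M) :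
    HasDerivAt (fun s => poissonDeriv α k s f x) (poissonDeriv α (k + 1) t f x) t :=
  hasDerivAt_subord k ht (stronglyMeasurable_heatSemigroup_inv hf x).aestronglyMeasurable
    (norm_heatSemigroup_inv_le hα hx hM)

/-- The heat semigroup commutes with the time derivatives of the Poisson semigroup. -/
theorem heatSemigroup_poissonDeriv (hα : ∀ i, -1 < α i) (k : ℕ) {t s : ℝ} (ht : 0 < t)
    (hs : 0 < s) {x : Fin d → ℝ} (hx : x ∈ posOrthant d) {f : (Fin d → ℝ) → 𝕜}
    (hf : StronglyMeasurable f) {M : ℝ} (hM : ∀ᵐ y ∂laguerreMeasure α, ‖f y‖ ≤ M) :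
    heatSemigroup α t (poissonDeriv α k s f) x
      = subord k s fun w => heatSemigroup α (t + (w ^ 2)⁻¹) f x := by
  have hint : Integrable (Function.uncurry fun (y : Fin d → ℝ) (w : ℝ) =>
      (heatKernel α t x y * subordKernel k s w) • heatSemigroup α (w ^ 2)⁻¹ f y)
      ((laguerreMeasure α).prod (volume.restrict (Ioi 0))) := by
    have hK : Integrable (fun p : (Fin d → ℝ) × ℝ => heatKernel α t x p.1 * subordKernel k s p.2)
        ((laguerreMeasure α).prod (volume.restrict (Ioi 0))) :=
      (integrable_heatKernel hα ht hx).mul_prod (integrable_subordKernel k hs).integrable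
    refine (hK.norm.mul_const M).mono' (hK.aestronglyMeasurable.smul
      ((stronglyMeasurable_heatSemigroup hf).comp_measurable
        (g := fun p : (Fin d → ℝ) × ℝ => ((p.2 ^ 2)⁻¹, p.1)) (by fun_prop)).aestronglyMeasurable) ?_
    have h1 := Measure.quasiMeasurePreserving_fst (μ := laguerreMeasure α)
      (ν := volume.restrict (Ioi (0 : ℝ))) |>.ae (ae_mem_posOrthant α)
    have h2 := Measure.quasiMeasurePreserving_snd (μ := laguerreMeasure α)
      (ν := volume.restrict (Ioi (0 : ℝ))) |>.ae (ae_restrict_mem measurableSet_Ioi)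
    filter_upwards [h1, h2] with p hp hq
    rw [Function.uncurry, norm_smul]
    exact mul_le_mul_of_nonneg_left (norm_heatSemigroup_inv_le hα hp hM _ hq) (norm_nonneg _)
  rw [heatSemigroup_of_pos ht]
  calc _ = ∫ y, (∫ w in Ioi (0 : ℝ),
        (heatKernel α t x y * subordKernel k s w) • heatSemigroup α (w ^ 2)⁻¹ f y)
          ∂laguerreMeasure α := by
        simp only [poissonDeriv, subord, mul_smul, integral_smul]
    _ = ∫ w in Ioi (0 : ℝ), ∫ y,
        (heatKernel α t x y * subordKernel k s w) • heatSemigroup α (w ^ 2)⁻¹ f y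
          ∂laguerreMeasure α := integral_integral_swap hint
    _ = _ := by
        refine setIntegral_congr_fun measurableSet_Ioi fun w hw => ?_
        have hw' : (0 : ℝ) < w := hw
        simp only [mul_comm (heatKernel α t x _), mul_smul, integral_smul]
        rw [← heatSemigroup_heatSemigroup hα ht (by positivity) hx hf hM, heatSemigroup_of_pos ht]

/-- `P_t (∂_s^k P_s f) = ∂_s^k P_{t+s} f`. -/
theorem poissonDeriv_zero_poissonDeriv (hα : ∀ i, -1 < α i) (k : ℕ) {t s : ℝ} (ht : 0 < t)
    (hs : 0 < s) {x : Fin d → ℝ} (hx : x ∈ posOrthant d) {f : (Fin d → ℝ) → 𝕜}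
    (hf : StronglyMeasurable f) {M : ℝ} (hM : ∀ᵐ y ∂laguerreMeasure α, ‖f y‖ ≤ M) :
    poissonDeriv α 0 t (poissonDeriv α k s f) x = poissonDeriv α k (t + s) f x := by
  have h := subord_zero_subord k ht hs (stronglyMeasurable_heatSemigroup_time (α := α) hf x)
    (fun t ht => norm_heatSemigroup_le hα ht hx hM)
  rw [poissonDeriv, poissonDeriv, ← h]
  exact subord_congr fun v hv => heatSemigroup_poissonDeriv hα k (by positivity) hs hx hf hM

theorem exists_norm_poissonDeriv_le (k : ℕ) :
    ∃ C : ℝ, 0 < C ∧ ∀ {𝕜 : Type*} [RCLike 𝕜] {d : ℕ} {α : Fin d → ℝ}, (∀ i, -1 < α i) →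
      ∀ (f : (Fin d → ℝ) → 𝕜) (M : ℝ), 0 ≤ M → (∀ᵐ y ∂laguerreMeasure α, ‖f y‖ ≤ M) →
        ∀ t : ℝ, 0 < t → ∀ x ∈ posOrthant d,
          ‖poissonDeriv α k t f x‖ ≤ C * t ^ (-(k : ℝ)) * M := by
  obtain ⟨C, hC, H⟩ := exists_norm_subord_le k
  exact ⟨C, hC, fun hα f M hM0 hM t ht x hx =>
    H t ht _ M hM0 (norm_heatSemigroup_inv_le hα hx hM)⟩

/-- Differentiating `P_t (∂_s^k P_s f) = ∂_s^k P_{t+s} f` in `t`. -/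
theorem poissonDeriv_one_poissonDeriv (hα : ∀ i, -1 < α i) (k : ℕ) {t s : ℝ} (ht : 0 < t)
    (hs : 0 < s) {x : Fin d → ℝ} (hx : x ∈ posOrthant d) {f : (Fin d → ℝ) → 𝕜}
    (hf : StronglyMeasurable f) {M : ℝ} (hM0 : 0 ≤ M)
    (hM : ∀ᵐ y ∂laguerreMeasure α, ‖f y‖ ≤ M) :
    poissonDeriv α 1 t (poissonDeriv α k s f) x = poissonDeriv α (k + 1) (t + s) f x := by
  obtain ⟨C, hC, H⟩ := exists_norm_poissonDeriv_le k
  have h1 := hasDerivAt_poissonDeriv hα 0 ht hx (stronglyMeasurable_poissonDeriv (α := α) hf k s)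
    (M := C * s ^ (-(k : ℝ)) * M)
    ((ae_mem_posOrthant α).mono fun y hy => H hα f M hM0 hM s hs y hy)
  have h2 : HasDerivAt (fun t => poissonDeriv α k (t + s) f x)
      (poissonDeriv α (k + 1) (t + s) f x) t :=
    (hasDerivAt_poissonDeriv hα k (add_pos ht hs) hx hf hM).comp_add_const t s
  refine h1.unique (h2.congr_of_eventuallyEq ?_)
  filter_upwards [Ioi_mem_nhds ht] with t' ht'
  exact poissonDeriv_zero_poissonDeriv hα k ht' hs hx hf hM

/-- Raising the order of the derivative by one: `∂_t` costs a factor `1 / t`, and the semigroup law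
separates it from the `k` derivatives that are controlled. -/
theorem exists_norm_poissonDeriv_succ_le (β : ℝ) (k : ℕ) :
    ∃ C : ℝ, 0 < C ∧ ∀ {𝕜 : Type*} [RCLike 𝕜] {d : ℕ} {α : Fin d → ℝ}, (∀ i, -1 < α i) →
      ∀ (f : (Fin d → ℝ) → 𝕜), StronglyMeasurable f →
        ∀ M : ℝ, 0 ≤ M → (∀ᵐ y ∂laguerreMeasure α, ‖f y‖ ≤ M) → ∀ A : ℝ, 0 ≤ A →
        (∀ t : ℝ, 0 < t → ∀ᵐ x ∂laguerreMeasure α,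
          ‖poissonDeriv α k t f x‖ ≤ A * t ^ (-(k : ℝ) + β)) →
        ∀ t : ℝ, 0 < t → ∀ x ∈ posOrthant d,
          ‖poissonDeriv α (k + 1) t f x‖ ≤ C * A * t ^ (-((k + 1 : ℕ) : ℝ) + β) := by
  obtain ⟨C, hC, H⟩ := exists_norm_poissonDeriv_le 1
  -- the time `t` is split into two halves, each of which contributes a power of `1 / 2`
  refine ⟨C * (1 / 2) ^ (-((k + 1 : ℕ) : ℝ) + β), by positivity,
    fun {_ _ _ _} hα f hf M hM0 hM A hA hk t ht x hx => ?_⟩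
  have ht2 : 0 < t / 2 := by positivity
  have h := H hα _ _ (by positivity) (hk (t / 2) ht2) (t / 2) ht2 x hx
  rw [poissonDeriv_one_poissonDeriv hα k ht2 ht2 hx hf hM0 hM, add_halves] at h
  refine h.trans (le_of_eq ?_)
  have e : (t / 2) ^ (-((k + 1 : ℕ) : ℝ) + β)
      = (t / 2) ^ (-((1 : ℕ) : ℝ)) * (t / 2) ^ (-(k : ℝ) + β) := by
    rw [← Real.rpow_add ht2]; congr 1; push_cast; ring
  have e2 : (t / 2) ^ (-((k + 1 : ℕ) : ℝ) + β)
      = (1 / 2) ^ (-((k + 1 : ℕ) : ℝ) + β) * t ^ (-((k + 1 : ℕ) : ℝ) + β) := by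
    rw [← Real.mul_rpow (by norm_num) ht.le]; congr 1; ring
  linear_combination (C * A) * e2 - (C * A) * e

open Filter Topology in
/-- Lowering the order of the derivative by one: integrate from `t` to infinity, where the
derivatives of positive order vanish. -/
theorem norm_poissonDeriv_le_of_succ (hα : ∀ i, -1 < α i) {β : ℝ} (hβ : 0 < β) {k : ℕ}
    (hk : β < k) {f : (Fin d → ℝ) → 𝕜} (hf : StronglyMeasurable f) {M : ℝ} (hM0 : 0 ≤ M)
    (hM : ∀ᵐ y ∂laguerreMeasure α, ‖f y‖ ≤ M) {A : ℝ}
    (hA : ∀ t : ℝ, 0 < t → ∀ᵐ x ∂laguerreMeasure α,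
      ‖poissonDeriv α (k + 1) t f x‖ ≤ A * t ^ (-((k + 1 : ℕ) : ℝ) + β)) :
    ∀ᵐ x ∂laguerreMeasure α, ∀ t : ℝ, 0 < t →
      ‖poissonDeriv α k t f x‖ ≤ A / (k - β) * t ^ (-(k : ℝ) + β) := by
  have hkβ : 0 < (k : ℝ) - β := by linarith
  have hrat : ∀ᵐ x ∂laguerreMeasure α, ∀ q : ℚ, 0 < (q : ℝ) →
      ‖poissonDeriv α (k + 1) q f x‖ ≤ A * (q : ℝ) ^ (-((k + 1 : ℕ) : ℝ) + β) :=
    ae_all_iff.2 fun q => by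
      by_cases hq : 0 < (q : ℝ)
      · exact (hA q hq).mono fun x hx _ => hx
      · exact Eventually.of_forall fun x h => absurd h hq
  filter_upwards [hrat, ae_mem_posOrthant α] with x hxq hx t ht
  have hderiv : ∀ s, 0 < s → HasDerivAt (fun s => poissonDeriv α k s f x)
      (poissonDeriv α (k + 1) s f x) s := fun s hs => hasDerivAt_poissonDeriv hα k hs hx hf hM
  -- by continuity in time, the bound at rational times extends to all times
  have hbound : ∀ s, 0 < s →
      ‖poissonDeriv α (k + 1) s f x‖ ≤ A * s ^ (-((k + 1 : ℕ) : ℝ) + β) := by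
    intro s hs
    by_contra hc
    have hc1 : ContinuousAt (fun s => ‖poissonDeriv α (k + 1) s f x‖) s :=
      (hasDerivAt_poissonDeriv hα (k + 1) hs hx hf hM).continuousAt.norm
    have hc2 : ContinuousAt (fun s : ℝ => A * s ^ (-((k + 1 : ℕ) : ℝ) + β)) s :=
      continuousAt_const.mul (Real.continuousAt_rpow_const _ _ (Or.inl hs.ne'))
    have hev := (hc2.eventually_lt hc1 (not_le.1 hc)).and (Ioi_mem_nhds hs)
    obtain ⟨a, b, hab, hsub⟩ := mem_nhds_iff_exists_Ioo_subset.1 hev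
    obtain ⟨q, hq1, hq2⟩ := exists_rat_btwn (hab.1.trans hab.2)
    obtain ⟨h1, h2⟩ := hsub ⟨hq1, hq2⟩
    exact absurd (hxq q h2) (not_le.2 h1)
  set G : ℝ → ℝ := fun s => A / (k - β) * s ^ (-(k : ℝ) + β) with hG
  have hG' : ∀ s, 0 < s → HasDerivAt G (-(A * s ^ (-((k + 1 : ℕ) : ℝ) + β))) s := by
    intro s hs
    refine ((Real.hasDerivAt_rpow_const (Or.inl hs.ne')).const_mul (A / (k - β))).congr_deriv ?_
    have e : -(k : ℝ) + β - 1 = -((k + 1 : ℕ) : ℝ) + β := by push_cast; ring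
    rw [e]
    field_simp
    ring
  have hdiff : ∀ T, t < T →
      ‖poissonDeriv α k T f x - poissonDeriv α k t f x‖ ≤ G t - G T := by
    intro T hT
    refine image_norm_le_of_norm_deriv_right_le_deriv_boundary' (a := t) (b := T)
      (f := fun s => poissonDeriv α k s f x - poissonDeriv α k t f x)
      (f' := fun s => poissonDeriv α (k + 1) s f x)
      (B := fun s => G t - G s) (B' := fun s => A * s ^ (-((k + 1 : ℕ) : ℝ) + β))
      ?_ ?_ (by simp) ?_ ?_ ?_ (right_mem_Icc.2 hT.le)
    · exact fun s hs => ((hderiv s (ht.trans_le hs.1)).sub_const _).continuousAt.continuousWithinAt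
    · exact fun s hs => ((hderiv s (ht.trans_le hs.1)).sub_const _).hasDerivWithinAt
    · exact fun s hs =>
        ((hG' s (ht.trans_le hs.1)).const_sub _).continuousAt.continuousWithinAt
    · intro s hs
      exact (((hG' s (ht.trans_le hs.1)).const_sub _).congr_deriv (neg_neg _)).hasDerivWithinAt
    · exact fun s hs => hbound s (ht.trans_le hs.1)
  obtain ⟨C, hC, H⟩ := exists_norm_poissonDeriv_le k
  have hlim : Tendsto (fun T : ℝ => G t + (C * T ^ (-(k : ℝ)) * M - G T)) atTop (𝓝 (G t)) := by
    have h1 : Tendsto (fun T : ℝ => T ^ (-(k : ℝ))) atTop (𝓝 0) :=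
      tendsto_rpow_neg_atTop (by linarith)
    have h2 : Tendsto (fun T : ℝ => T ^ (-(k : ℝ) + β)) atTop (𝓝 0) := by
      have := tendsto_rpow_neg_atTop hkβ
      rwa [neg_sub, sub_eq_neg_add] at this
    simpa using (((h1.const_mul C).mul_const M).sub (h2.const_mul (A / (k - β)))).const_add (G t)
  refine ge_of_tendsto hlim ?_
  filter_upwards [eventually_gt_atTop t] with T hT
  have h1 := H hα f M hM0 hM T (ht.trans hT) x hx
  have h2 := hdiff T hT
  have h3 := norm_sub_norm_le (poissonDeriv α k t f x) (poissonDeriv α k T f x)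
  rw [norm_sub_rev] at h3
  linarith

end Laguerre

/-! ### Comparison of the Lipschitz conditions -/

namespace Laguerre

section Comparison

variable {𝕜 : Type*} [RCLike 𝕜] {d : ℕ} {α : Fin d → ℝ}

/-- The pointwise definition of `T_t f` for `t > 0` does not see the choice of a representative, so
`f` may be replaced by a strongly measurable function, for which time and space are jointly
measurable. -/
theorem exists_bounded_representative {f : (Fin d → ℝ) → 𝕜}
    (hf : MemLp f ∞ (laguerreMeasure α)) :
    ∃ g : (Fin d → ℝ) → 𝕜, StronglyMeasurable g ∧ f =ᵐ[laguerreMeasure α] g ∧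
      ∃ M : ℝ, 0 ≤ M ∧ ∀ᵐ y ∂laguerreMeasure α, ‖g y‖ ≤ M := by
  refine ⟨hf.1.mk f, hf.1.stronglyMeasurable_mk, hf.1.ae_eq_mk,
    (eLpNorm f ∞ (laguerreMeasure α)).toReal, ENNReal.toReal_nonneg, ?_⟩
  filter_upwards [hf.1.ae_eq_mk, ae_le_eLpNormEssSup (f := f) (μ := laguerreMeasure α)] with y h1 h2
  rw [← h1, ← toReal_enorm]
  refine ENNReal.toReal_mono hf.2.ne ?_
  rwa [eLpNorm_exponent_top]

theorem poissonSemigroup_eq_poissonDeriv {f g : (Fin d → ℝ) → 𝕜}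
    (hfg : f =ᵐ[laguerreMeasure α] g) {t : ℝ} (ht : 0 < t) (x : Fin d → ℝ) :
    poissonSemigroup α t f x = poissonDeriv α 0 t g x := by
  rw [poissonSemigroup_eq_subord ht]
  exact subord_congr fun v hv => heatSemigroup_congr_ae (by positivity) hfg x

theorem iteratedDeriv_poissonSemigroup (hα : ∀ i, -1 < α i) (k : ℕ) {f g : (Fin d → ℝ) → 𝕜}
    (hfg : f =ᵐ[laguerreMeasure α] g) (hg : StronglyMeasurable g) {M : ℝ}
    (hM : ∀ᵐ y ∂laguerreMeasure α, ‖g y‖ ≤ M) {t : ℝ} (ht : 0 < t) {x : Fin d → ℝ}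
    (hx : x ∈ posOrthant d) :
    iteratedDeriv k (fun s => poissonSemigroup α s f x) t = poissonDeriv α k t g x := by
  have : (fun s => poissonSemigroup α s f x) =ᶠ[nhds t] fun s => poissonDeriv α 0 s g x := by
    filter_upwards [Ioi_mem_nhds ht] with s hs using poissonSemigroup_eq_poissonDeriv hfg hs x
  rw [this.iteratedDeriv_eq k]
  exact iteratedDeriv_subord k ht (stronglyMeasurable_heatSemigroup_inv hg x).aestronglyMeasurable
    (norm_heatSemigroup_inv_le hα hx hM)

theorem contDiffOn_poissonSemigroup (hα : ∀ i, -1 < α i) {f : (Fin d → ℝ) → 𝕜}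
    (hf : MemLp f ∞ (laguerreMeasure α)) {x : Fin d → ℝ} (hx : x ∈ posOrthant d) :
    ContDiffOn ℝ ((⊤ : ℕ∞) : WithTop ℕ∞) (fun t : ℝ => poissonSemigroup α t f x) (Ioi 0) := by
  obtain ⟨g, hg, hfg, M, -, hM⟩ := exists_bounded_representative hf
  exact (contDiffOn_subord 0 (stronglyMeasurable_heatSemigroup_inv hg x).aestronglyMeasurable
    (norm_heatSemigroup_inv_le hα hx hM)).congr fun t ht =>
      poissonSemigroup_eq_poissonDeriv hfg ht x

theorem eLpNorm_top_le_ofReal_iff {Ω : Type*} {m : MeasurableSpace Ω} {μ : Measure Ω} {u : Ω → 𝕜}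
    {c : ℝ} (hc : 0 ≤ c) : eLpNorm u ∞ μ ≤ ENNReal.ofReal c ↔ ∀ᵐ x ∂μ, ‖u x‖ ≤ c := by
  rw [eLpNorm_exponent_top]
  refine ⟨fun h => ?_, eLpNormEssSup_le_of_ae_bound⟩
  filter_upwards [ae_le_eLpNormEssSup (f := u) (μ := μ)] with x hx
  rw [← toReal_enorm]
  exact ENNReal.toReal_le_of_le_ofReal hc (hx.trans h)

theorem derivBound_iff (hα : ∀ i, -1 < α i) {β : ℝ} (k : ℕ) {f g : (Fin d → ℝ) → 𝕜}
    (hfg : f =ᵐ[laguerreMeasure α] g) (hg : StronglyMeasurable g) {M : ℝ}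
    (hM : ∀ᵐ y ∂laguerreMeasure α, ‖g y‖ ≤ M) {A : ℝ} (hA : 0 ≤ A) :
    DerivBound α β k f A ↔ ∀ t : ℝ, 0 < t → ∀ᵐ x ∂laguerreMeasure α,
      ‖poissonDeriv α k t g x‖ ≤ A * t ^ (-(k : ℝ) + β) := by
  refine forall₂_congr fun t ht => ?_
  rw [eLpNorm_top_le_ofReal_iff (by positivity)]
  have : ∀ᵐ x ∂laguerreMeasure α, iteratedDeriv k (fun s => poissonSemigroup α s f x) t
      = poissonDeriv α k t g x :=
    (ae_mem_posOrthant α).mono fun x hx =>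
      iteratedDeriv_poissonSemigroup hα k hfg hg hM ht hx
  exact Filter.eventually_congr (this.mono fun x hx => by rw [hx])

theorem DerivBound.mono {β : ℝ} {k : ℕ} {f : (Fin d → ℝ) → 𝕜} {A B : ℝ} (hAB : A ≤ B)
    (h : DerivBound α β k f A) : DerivBound α β k f B := fun t ht =>
  (h t ht).trans (ENNReal.ofReal_le_ofReal (mul_le_mul_of_nonneg_right hAB (by positivity)))

/-- The sign of `A` is no restriction: the right-hand side of `DerivBound` is truncated at `0`. -/
theorem admissibleConsts_nonempty_iff {β : ℝ} {k : ℕ} {f : (Fin d → ℝ) → 𝕜} :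
    (admissibleConsts α β k f).Nonempty ↔ ∃ A : ℝ, DerivBound α β k f A :=
  ⟨fun ⟨A, hA⟩ => ⟨A, hA.2⟩,
    fun ⟨A, hA⟩ => ⟨max A 0, le_max_right _ _, hA.mono (le_max_left _ _)⟩⟩

/-- For each `t` the condition on `A` is closed, so the infimum of the admissible constants is
attained. -/
theorem isLeast_smallestConst {β : ℝ} {k : ℕ} {f : (Fin d → ℝ) → 𝕜}
    (h : ∃ A : ℝ, DerivBound α β k f A) :
    IsLeast (admissibleConsts α β k f) (smallestConst α β k f) := by
  have hclosed : IsClosed (admissibleConsts α β k f) := by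
    have : admissibleConsts α β k f = Ici 0 ∩ ⋂ (t : ℝ) (_ : 0 < t),
        {A : ℝ | eLpNorm (fun x => iteratedDeriv k (fun s : ℝ => poissonSemigroup α s f x) t) ∞
          (laguerreMeasure α) ≤ ENNReal.ofReal (A * t ^ (-(k : ℝ) + β))} := by
      ext A
      simp [admissibleConsts, DerivBound]
    rw [this]
    refine isClosed_Ici.inter (isClosed_iInter fun t => isClosed_iInter fun _ => ?_)
    exact isClosed_le continuous_const (ENNReal.continuous_ofReal.comp (by fun_prop))
  have hbdd : BddBelow (admissibleConsts α β k f) := ⟨0, fun A hA => hA.1⟩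
  exact ⟨hclosed.csInf_mem (admissibleConsts_nonempty_iff.2 h) hbdd, fun A hA => csInf_le hbdd hA⟩

theorem exists_derivBound_succ (hα : ∀ i, -1 < α i) (β : ℝ) (k : ℕ) :
    ∃ C : ℝ, 0 < C ∧ ∀ f : (Fin d → ℝ) → 𝕜, MemLp f ∞ (laguerreMeasure α) → ∀ A : ℝ, 0 ≤ A →
      DerivBound α β k f A → DerivBound α β (k + 1) f (C * A) := by
  obtain ⟨C, hC, H⟩ := exists_norm_poissonDeriv_succ_le β k
  refine ⟨C, hC, fun f hf A hA h => ?_⟩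
  obtain ⟨g, hg, hfg, M, hM0, hM⟩ := exists_bounded_representative hf
  rw [derivBound_iff hα k hfg hg hM hA] at h
  rw [derivBound_iff hα (k + 1) hfg hg hM (by positivity)]
  exact fun t ht => (ae_mem_posOrthant α).mono fun x hx => H hα g hg M hM0 hM A hA h t ht x hx

theorem DerivBound.of_succ (hα : ∀ i, -1 < α i) {β : ℝ} (hβ : 0 < β) {k : ℕ} (hk : β < k)
    {f : (Fin d → ℝ) → 𝕜} (hf : MemLp f ∞ (laguerreMeasure α)) {A : ℝ} (hA : 0 ≤ A)
    (h : DerivBound α β (k + 1) f A) : DerivBound α β k f (((k : ℝ) - β)⁻¹ * A) := by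
  obtain ⟨g, hg, hfg, M, hM0, hM⟩ := exists_bounded_representative hf
  have hkβ : 0 < (k : ℝ) - β := by linarith
  rw [derivBound_iff hα (k + 1) hfg hg hM hA] at h
  rw [derivBound_iff hα k hfg hg hM (by positivity)]
  intro t ht
  filter_upwards [norm_poissonDeriv_le_of_succ hα hβ hk hg hM0 hM h] with x hx
  rw [inv_mul_eq_div]
  exact hx t ht

/-- The conditions of any two orders greater than `β` imply each other, with a factor that does not
depend on the function. -/
theorem exists_derivBound_of_lt (𝕜 : Type*) [RCLike 𝕜] (hα : ∀ i, -1 < α i) {β : ℝ} (hβ : 0 < β)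
    {k l : ℕ} (hk : β < k) (hl : β < l) :
    ∃ C : ℝ, 0 < C ∧ ∀ f : (Fin d → ℝ) → 𝕜, MemLp f ∞ (laguerreMeasure α) → ∀ A : ℝ, 0 ≤ A →
      DerivBound α β k f A → DerivBound α β l f (C * A) := by
  rcases le_total k l with hkl | hkl
  · induction l, hkl using Nat.le_induction with
    | base => exact ⟨1, one_pos, fun f _ A _ h => by rwa [one_mul]⟩
    | succ l hkl ih =>
      obtain ⟨C, hC, H⟩ := ih (hk.trans_le (by exact_mod_cast hkl))
      obtain ⟨D, hD, H'⟩ := exists_derivBound_succ (𝕜 := 𝕜) hα β l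
      refine ⟨D * C, by positivity, fun f hf A hA h => ?_⟩
      rw [mul_assoc]
      exact H' f hf _ (by positivity) (H f hf A hA h)
  · induction k, hkl using Nat.le_induction with
    | base => exact ⟨1, one_pos, fun f _ A _ h => by rwa [one_mul]⟩
    | succ k hkl ih =>
      have hk' : β < k := hl.trans_le (by exact_mod_cast hkl)
      have hkβ : 0 < (k : ℝ) - β := by linarith
      obtain ⟨C, hC, H⟩ := ih hk'
      refine ⟨C * ((k : ℝ) - β)⁻¹, by positivity, fun f hf A hA h => ?_⟩
      rw [mul_assoc]
      exact H f hf _ (by positivity) (h.of_succ hα hβ hk' hf hA)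

theorem exists_derivBound_imp (hα : ∀ i, -1 < α i) {β : ℝ} (hβ : 0 < β) {k l : ℕ} (hk : β < k)
    (hl : β < l) {f : (Fin d → ℝ) → 𝕜} (hf : MemLp f ∞ (laguerreMeasure α))
    (h : ∃ A : ℝ, DerivBound α β k f A) : ∃ A : ℝ, DerivBound α β l f A := by
  obtain ⟨C, -, H⟩ := exists_derivBound_of_lt 𝕜 hα hβ hk hl
  obtain ⟨A, hA⟩ := admissibleConsts_nonempty_iff.2 h
  exact ⟨C * A, H f hf A hA.1 hA.2⟩

end Comparison

end Laguerre

theorem proposition3p1 {𝕜 : Type*} [RCLike 𝕜] {d : ℕ} (α : Fin d → ℝ) (hα : ∀ i, -(1 / 2 : ℝ) < α i)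
    (β : ℝ) (hβ : 0 < β) (k l : ℕ) (hk : β < (k : ℝ)) (hl : β < (l : ℝ)) :
    (∃ C : ℝ, 0 < C ∧ ∀ f : (Fin d → ℝ) → 𝕜, MemLp f ∞ (Laguerre.laguerreMeasure α) →
      (∀ x ∈ Laguerre.posOrthant d,
        ContDiffOn ℝ ((⊤ : ℕ∞) : WithTop ℕ∞)
          (fun t : ℝ => Laguerre.poissonSemigroup α t f x) (Ioi 0)) ∧
      ((∃ A : ℝ, Laguerre.DerivBound α β k f A) ↔ ∃ A : ℝ, Laguerre.DerivBound α β l f A) ∧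
      ((∃ A : ℝ, Laguerre.DerivBound α β k f A) →
        IsLeast (Laguerre.admissibleConsts α β k f) (Laguerre.smallestConst α β k f) ∧
        IsLeast (Laguerre.admissibleConsts α β l f) (Laguerre.smallestConst α β l f) ∧
        Laguerre.smallestConst α β k f ≤ C * Laguerre.smallestConst α β l f ∧
        Laguerre.smallestConst α β l f ≤ C * Laguerre.smallestConst α β k f)) ∧
    Laguerre.lip 𝕜 α β = Laguerre.lipOfOrder 𝕜 α β k := by
  have hα' : ∀ i, -1 < α i := fun i => by linarith [hα i]
  refine ⟨?_, ?_⟩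
  · obtain ⟨C, hC, H⟩ := Laguerre.exists_derivBound_of_lt 𝕜 hα' hβ hk hl
    obtain ⟨D, hD, H'⟩ := Laguerre.exists_derivBound_of_lt 𝕜 hα' hβ hl hk
    refine ⟨max C D, hC.trans_le (le_max_left _ _), fun f hf =>
      ⟨fun x hx => Laguerre.contDiffOn_poissonSemigroup hα' hf hx,
        ⟨Laguerre.exists_derivBound_imp hα' hβ hk hl hf,
          Laguerre.exists_derivBound_imp hα' hβ hl hk hf⟩, fun h => ?_⟩⟩
    have hK := Laguerre.isLeast_smallestConst h
    have hL := Laguerre.isLeast_smallestConst (Laguerre.exists_derivBound_imp hα' hβ hk hl hf h)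
    refine ⟨hK, hL, ?_, ?_⟩
    · refine (hK.2 ⟨mul_nonneg hD.le hL.1.1, H' f hf _ hL.1.1 hL.1.2⟩).trans ?_
      exact mul_le_mul_of_nonneg_right (le_max_right _ _) hL.1.1
    · refine (hL.2 ⟨mul_nonneg hC.le hK.1.1, H f hf _ hK.1.1 hK.1.2⟩).trans ?_
      exact mul_le_mul_of_nonneg_right (le_max_left _ _) hK.1.1
  · have hn : β < ((⌊β⌋₊ + 1 : ℕ) : ℝ) := by exact_mod_cast Nat.lt_floor_add_one β
    ext f
    refine and_congr_right fun hf => ?_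
    rw [Laguerre.admissibleConsts_nonempty_iff, Laguerre.admissibleConsts_nonempty_iff]
    exact ⟨Laguerre.exists_derivBound_imp hα' hβ hn hk hf,
      Laguerre.exists_derivBound_imp hα' hβ hk hn hf⟩
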